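/- Let $(M,g)$ be a compact connected smooth Riemannian manifold (without boundary) with a smooth isometric action of a compact Lie group $G$ of cohomogeneity one, i.e. with at least one orbit of codimension $1$, and suppose that the orbit space is $M/G=[-1,1]$. Fix a horizontal geodesic $\gamma:\mathbb R\to M$, i.e. a geodesic perpendicular to all orbits which is an infinite horizontal lift of $M/G=[-1,1]$: for a homeomorphism $M/G\cong[-1,1]$, the orbit of $\gamma(t)$ corresponds to $t$ for all $t\in[-1,1]$. Let $H=G_{\gamma(0)}$ be the principal isotropy group, and let $K=G_{\gamma(\tau)}$ with $\tau=1$ or $\tau=-1$ be the isotropy group of a boundary orbit $S=G\cdot\gamma(\tau)\cong G/K$ which is singular, i.e. $\dim S<\dim G\cdot\gamma(0)$. For $p\in S$ and $\varepsilon>0$ let $$D_\varepsilon(p)=\{\exp_p v : v\in T_pM,\ v\perp T_pS,\ |v|<\varepsilon\}$$ be the slice (normal disk) of $S$ at $p$. Then, for every $t\in\mathbb R$ with $\gamma(t)\in S$ and every $\varepsilon>0$, the group $H$ is a normal subgroup of $K$ (in particular contained in it) if and only if $H$ acts trivially on $D_\varepsilon(\gamma(t))$, i.e. $h\cdot q=q$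 for all $h\in H$ and $q\in D_\varepsilon(\gamma(t))$. -/

import Mathlib

open scoped Manifold ContDiff

noncomputable section CohomogeneityOne

variable {E : Type*} [NormedAddCommGroup E] [NormedSpace ℝ E]
  {M : Type*} [TopologicalSpace M] [ChartedSpace E M] [IsManifold 𝓘(ℝ, E) ∞ M]

/-- The velocity vector `c'(t)` of a curve `c : ℝ → M`. -/
def velocity (c : ℝ → M) (t : ℝ) : TangentSpace 𝓘(ℝ, E) (c t) :=
  mfderiv 𝓘(ℝ, ℝ) 𝓘(ℝ, E) c t (1 : ℝ)

/-- The coordinate expression of the Riemannian metric `g` in a chart `e`: at the point `y` of the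
target of `e`, it is the bilinear form `(v, w) ↦ g (d(e⁻¹) v, d(e⁻¹) w)` on the model space. -/
def metricInChart
    (g : Bundle.ContMDiffRiemannianMetric 𝓘(ℝ, E) ∞ E (fun x : M => TangentSpace 𝓘(ℝ, E) x))
    (e : OpenPartialHomeomorph M E) (y v w : E) : ℝ :=
  g.inner (e.symm y) (mfderiv 𝓘(ℝ, E) 𝓘(ℝ, E) e.symm y v) (mfderiv 𝓘(ℝ, E) 𝓘(ℝ, E) e.symm y w)

/-- A (possibly constant, affinely parametrized) geodesic `c : ℝ → M` of the Riemannian metric `g`: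
a smooth curve which in every chart of the smooth structure solves the geodesic equation.
In coordinates with metric coefficients `g_ij`, the condition below reads
`d/dt (g_ij(x) x'^i) w^j = (1/2) (∂_j g_ik)(x) x'^i x'^k w^j` for all `w`; raising the index
with the inverse metric, this is `x''^l + Γ^l_ik x'^i x'^k = 0` with the Christoffel symbols of the
Levi-Civita connection. -/
def IsGeodesic
    (g : Bundle.ContMDiffRiemannianMetric 𝓘(ℝ, E) ∞ E (fun x : M => TangentSpace 𝓘(ℝ, E) x))
    (c : ℝ → M) : Prop :=
  ContMDiff 𝓘(ℝ, ℝ) 𝓘(ℝ, E) ∞ c ∧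
    ∀ e ∈ IsManifold.maximalAtlas 𝓘(ℝ, E) ∞ M, ∀ t : ℝ, c t ∈ e.source → ∀ w : E,
      deriv (fun s => metricInChart g e (e (c s)) (deriv (fun r => e (c r)) s) w) t =
        (1 / 2 : ℝ) * fderiv ℝ
          (fun y => metricInChart g e y (deriv (fun r => e (c r)) t) (deriv (fun r => e (c r)) t))
          (e (c t)) w

variable {EG : Type*} [NormedAddCommGroup EG] [NormedSpace ℝ EG]
  (G : Type*) [Group G] [TopologicalSpace G] [ChartedSpace EG G] [MulAction G M]

/-- The tangent space `T_x(G x)` of the orbit of `x` under a smooth action of the Lie group `G`: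
the image of `T_1 G` under the differential at `1` of the orbit map `a ↦ a • x`. -/
def orbitTangentSpace (x : M) : Submodule ℝ (TangentSpace 𝓘(ℝ, E) x) :=
  LinearMap.range
    (mfderiv 𝓘(ℝ, EG) 𝓘(ℝ, E) (fun a : G => a • x) (1 : G) :
      TangentSpace 𝓘(ℝ, EG) (1 : G) →L[ℝ] TangentSpace 𝓘(ℝ, E) ((1 : G) • x)).toLinearMap

/-- The dimension of the orbit of `x`. -/
def orbitDim (x : M) : ℕ :=
  Module.finrank ℝ (orbitTangentSpace (E := E) (EG := EG) G x)

/-- The curve `c` is perpendicular to the orbit through `c t` at time `t`. -/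
def IsPerpToOrbitAt
    (g : Bundle.ContMDiffRiemannianMetric 𝓘(ℝ, E) ∞ E (fun x : M => TangentSpace 𝓘(ℝ, E) x))
    (c : ℝ → M) (t : ℝ) : Prop :=
  ∀ v ∈ orbitTangentSpace (E := E) (EG := EG) G (c t), g.inner (c t) (velocity c t) v = 0

/-- The action of `G` on `(M, g)` is isometric and has at least one orbit of codimension one. -/
structure IsCohomogeneityOne
    (g : Bundle.ContMDiffRiemannianMetric 𝓘(ℝ, E) ∞ E (fun x : M => TangentSpace 𝓘(ℝ, E) x)) :
    Prop where
  isometric : ∀ (a : G) (x : M) (v w : TangentSpace 𝓘(ℝ, E) x),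
    g.inner (a • x) (mfderiv 𝓘(ℝ, E) 𝓘(ℝ, E) (fun y : M => a • y) x v)
      (mfderiv 𝓘(ℝ, E) 𝓘(ℝ, E) (fun y : M => a • y) x w) = g.inner x v w
  exists_codim_one : ∃ x : M, orbitDim (E := E) (EG := EG) G x + 1 = Module.finrank ℝ E

/-- The curve `γ : ℝ → M` is an infinite horizontal lift of the orbit space `M / G = [-1, 1]`:
a geodesic perpendicular to all orbits that it meets, such that `M / G` is identified with
`[-1, 1]` by a homeomorphism sending the orbit of `γ t` to `t`, for `-1 ≤ t ≤ 1`. -/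
structure IsHorizontalLift
    (g : Bundle.ContMDiffRiemannianMetric 𝓘(ℝ, E) ∞ E (fun x : M => TangentSpace 𝓘(ℝ, E) x))
    (γ : ℝ → M) : Prop where
  geodesic : IsGeodesic g γ
  perp : ∀ t : ℝ, IsPerpToOrbitAt (EG := EG) G g γ t
  orbitSpace : ∃ φ : Quotient (MulAction.orbitRel G M) ≃ₜ Set.Icc (-1 : ℝ) 1,
    ∀ t ∈ Set.Icc (-1 : ℝ) 1, (φ (Quotient.mk _ (γ t)) : ℝ) = t

/-- The slice at `p` of the orbit `S` of `p`, i.e. the normal disk of radius `ε` to `S` at `p`: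
all points `exp_p v`, where `v` is a tangent vector at `p` perpendicular to `S` of length `< ε`.
Here `exp_p v = c 1` for the geodesic `c` with `c 0 = p` and `c' 0 = v`. -/
def slice
    (g : Bundle.ContMDiffRiemannianMetric 𝓘(ℝ, E) ∞ E (fun x : M => TangentSpace 𝓘(ℝ, E) x))
    (p : M) (ε : ℝ) : Set M :=
  {q | ∃ c : ℝ → M, IsGeodesic g c ∧ c 0 = p ∧ IsPerpToOrbitAt (EG := EG) G g c 0 ∧
    Real.sqrt (g.inner (c 0) (velocity c 0) (velocity c 0)) < ε ∧ c 1 = q}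

end CohomogeneityOne

open Filter Topology
set_option maxSynthPendingDepth 3

/-! Everything reduces to two facts. (1) `H` fixes `γ` pointwise, so `H` is exactly the pointwise
stabilizer of `γ` (`smul_eq_of_smul_zero_eq`). (2) Every geodesic starting at `γ τ` perpendicularly
to `S` has the form `r ↦ k • γ (τ + a * r)` with `k ∈ K` (`exists_eq_smul_comp_affine`). Hence `h`
fixes the slice at `γ τ` iff `k⁻¹ * h * k` fixes `γ` for every `k ∈ K`, a short segment being enough
by uniqueness of geodesics. Asking this of all `h ∈ H` is normality. At another time `t` with `γ t ∈
S`, some `b` carries `γ` near `t` to `γ` near `τ`; it maps `γ` onto itself, so it normalizes `H` and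
transports the statement from `γ τ` to `γ t`.

Fact (2) is infinitesimal: a normal vector `v` at `p = γ t` is a multiple of the velocity of some
translate `k • γ` with `k • p = p` (`exists_eq_smul_chartVelocity`). A curve `c` with velocity `v`
is written `c r = a r • γ (s r)`, and `k` is a limit of the `a r`. To first order, the displacement
from `p` to `a r • p'`, with `p' = γ t`, is tangent to the orbit (`isLittleO_normal_displacement`),
so normal components can be compared.

For fact (1), if the normal space at `γ 0` had dimension at least two, its sphere would be
connected. By the same infinitesimal statement it is the union of a compact set of velocities of
translates of `γ` and the negative of that set. These are disjoint, since otherwise `γ 1` and `γ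
(-1)` would share an orbit. So the normal space is a line, and an element fixing `γ 0` cannot
reverse it. -/

/-! ### The geodesic equation in coordinates and its local uniqueness. -/

/-- A nondegenerate bilinear form on a finite-dimensional space is a linear equivalence with the
dual. -/
theorem exists_continuousLinearEquiv_of_pos {E : Type*} [NormedAddCommGroup E] [NormedSpace ℝ E]
    [FiniteDimensional ℝ E] (B : E →L[ℝ] E →L[ℝ] ℝ) (hB : ∀ v, v ≠ 0 → 0 < B v v) :
    ∃ e : E ≃L[ℝ] (E →L[ℝ] ℝ), (e : E →L[ℝ] E →L[ℝ] ℝ) = B := by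
  have : CompleteSpace E := FiniteDimensional.complete ℝ E
  have hinj : Function.Injective B.toLinearMap := by
    rw [← LinearMap.ker_eq_bot, LinearMap.ker_eq_bot']
    intro v hv
    by_contra hne
    have := hB v hne
    have h0 : B v = 0 := hv
    simp [h0] at this
  have hfin : Module.finrank ℝ E = Module.finrank ℝ (E →L[ℝ] ℝ) := by
    rw [← (LinearMap.toContinuousLinearMap : (E →ₗ[ℝ] ℝ) ≃ₗ[ℝ] (E →L[ℝ] ℝ)).finrank_eq]
    exact Subspace.dual_finrank_eq.symm
  have hsurj := (LinearMap.injective_iff_surjective_of_finrank_eq_finrank hfin).1 hinj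
  exact ⟨ContinuousLinearEquiv.ofBijective B (LinearMap.ker_eq_bot.2 hinj)
    (LinearMap.range_eq_top.2 hsurj), ContinuousLinearEquiv.coe_ofBijective _ _ _⟩

theorem contDiffAt_clm_flip {D E F A : Type*} [NormedAddCommGroup D] [NormedSpace ℝ D]
    [NormedAddCommGroup E] [NormedSpace ℝ E] [NormedAddCommGroup F] [NormedSpace ℝ F]
    [NormedAddCommGroup A] [NormedSpace ℝ A] {n : WithTop ℕ∞} {f : D → E →L[ℝ] F →L[ℝ] A} {z : D}
    (hf : ContDiffAt ℝ n f z) : ContDiffAt ℝ n (fun z => (f z).flip) z :=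
  (ContinuousLinearMap.flipₗᵢ ℝ E F A).contDiff.contDiffAt.comp z hf

/-- The right-hand side of the geodesic equation `G(x) x'' = A(x, x')` in coordinates. -/
noncomputable def geodesicForce {E : Type*} [NormedAddCommGroup E] [NormedSpace ℝ E]
    (G : E → E →L[ℝ] E →L[ℝ] ℝ) (z : E × E) : E →L[ℝ] ℝ :=
  (1 / 2 : ℝ) • ((fderiv ℝ G z.1).flip z.2).flip z.2 - fderiv ℝ G z.1 z.2 z.2

theorem contDiffAt_geodesicForce {E : Type*} [NormedAddCommGroup E] [NormedSpace ℝ E]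
    {G : E → E →L[ℝ] E →L[ℝ] ℝ} {z : E × E}
    (hG : ContDiffAt ℝ 2 G z.1) : ContDiffAt ℝ 1 (geodesicForce G) z := by
  have hd : ContDiffAt ℝ 1 (fun z : E × E => fderiv ℝ G z.1) z :=
    ContDiffAt.comp z (hG.fderiv_right (m := 1) (by norm_num)) contDiffAt_fst
  exact (((contDiffAt_clm_flip ((contDiffAt_clm_flip hd).clm_apply contDiffAt_snd)).clm_apply
    contDiffAt_snd).const_smul _).sub ((hd.clm_apply contDiffAt_snd).clm_apply contDiffAt_snd)

/-- The coordinate form of a geodesic solves the first order system. -/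
theorem geodesic_hasDerivAt {E : Type*} [NormedAddCommGroup E] [NormedSpace ℝ E]
    [FiniteDimensional ℝ E] {G : E → E →L[ℝ] E →L[ℝ] ℝ} {x : ℝ → E} {s : ℝ}
    (hG : ContDiffAt ℝ 2 G (x s)) (hpos : ∀ v, v ≠ 0 → 0 < G (x s) v v)
    (hx : ContDiffAt ℝ 2 x s)
    (heq : ∀ w, deriv (fun r => G (x r) (deriv x r) w) s =
      (1 / 2 : ℝ) * fderiv ℝ (fun y => G y (deriv x s) (deriv x s)) (x s) w) :
    HasDerivAt (fun r => (x r, deriv x r))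
      (deriv x s, ContinuousLinearMap.inverse (G (x s)) (geodesicForce G (x s, deriv x s))) s := by
  have hx1 : HasDerivAt x (deriv x s) s := (hx.differentiableAt (by norm_num)).hasDerivAt
  have hx2 : HasDerivAt (deriv x) (deriv (deriv x) s) s := by
    have : ContDiffAt ℝ 1 (deriv x) s := by
      have h : ContDiffAt ℝ 1 (fderiv ℝ x) s := hx.fderiv_right (by norm_num)
      exact h.clm_apply contDiffAt_const
    exact (this.differentiableAt (by norm_num)).hasDerivAt
  have hGd : HasFDerivAt G (fderiv ℝ G (x s)) (x s) :=
    (hG.differentiableAt (by norm_num)).hasFDerivAt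
  refine hx1.prodMk ?_
  convert hx2 using 1
  obtain ⟨e, he⟩ := exists_continuousLinearEquiv_of_pos (G (x s)) hpos
  -- Expanding the time derivative of `G(x) x'` by the product rule isolates `G(x) x''`; inverting
  -- `G(x)` then solves for `x''`.
  have key : geodesicForce G (x s, deriv x s) = G (x s) (deriv (deriv x) s) := by
    ext w
    have h1 : HasDerivAt (fun r => G (x r) (deriv x r) w)
        ((fderiv ℝ G (x s) (deriv x s) (deriv x s) + G (x s) (deriv (deriv x) s)) w) s := by
      have := (hGd.comp_hasDerivAt s hx1).clm_apply hx2
      simpa using this.clm_apply (hasDerivAt_const s w)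
    have h2 : HasFDerivAt (fun y => G y (deriv x s) (deriv x s))
        (((fderiv ℝ G (x s)).flip (deriv x s)).flip (deriv x s)) (x s) := by
      have := (hGd.clm_apply (hasFDerivAt_const (deriv x s) (x s))).clm_apply
        (hasFDerivAt_const (deriv x s) (x s))
      refine this.congr_fderiv ?_
      ext w
      simp
    have h := heq w
    rw [h1.deriv, h2.fderiv] at h
    simp only [geodesicForce, _root_.sub_apply, _root_.smul_apply,
      smul_eq_mul, _root_.add_apply] at h ⊢
    linarith
  rw [key, ← he, ContinuousLinearMap.inverse_equiv]
  simp

/-- Local uniqueness for the geodesic equation in coordinates. -/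
theorem geodesic_coord_unique {E : Type*} [NormedAddCommGroup E] [NormedSpace ℝ E]
    [FiniteDimensional ℝ E] {G : E → E →L[ℝ] E →L[ℝ] ℝ} {x y : ℝ → E} {t : ℝ}
    (hG : ∀ᶠ z in 𝓝 (x t), ContDiffAt ℝ 2 G z ∧ ∀ v, v ≠ 0 → 0 < G z v v)
    (hx : ∀ᶠ s in 𝓝 t, ContDiffAt ℝ 2 x s) (hy : ∀ᶠ s in 𝓝 t, ContDiffAt ℝ 2 y s)
    (hxeq : ∀ᶠ s in 𝓝 t, ∀ w, deriv (fun r => G (x r) (deriv x r) w) s =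
      (1 / 2 : ℝ) * fderiv ℝ (fun z => G z (deriv x s) (deriv x s)) (x s) w)
    (hyeq : ∀ᶠ s in 𝓝 t, ∀ w, deriv (fun r => G (y r) (deriv y r) w) s =
      (1 / 2 : ℝ) * fderiv ℝ (fun z => G z (deriv y s) (deriv y s)) (y s) w)
    (h0 : x t = y t) (h1 : deriv x t = deriv y t) : x =ᶠ[𝓝 t] y := by
  have : CompleteSpace E := FiniteDimensional.complete ℝ E
  set V : E × E → E × E := fun z =>
    (z.2, ContinuousLinearMap.inverse (G z.1) (geodesicForce G z)) with hV
  -- Inversion of operators is smooth near an invertible one, so the first order system has a C¹,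
  -- hence locally Lipschitz, right-hand side.
  have hVs : ContDiffAt ℝ 1 V (x t, deriv x t) := by
    refine contDiffAt_snd.prodMk (ContDiffAt.clm_apply ?_
      (contDiffAt_geodesicForce hG.self_of_nhds.1))
    obtain ⟨e, he⟩ := exists_continuousLinearEquiv_of_pos _ hG.self_of_nhds.2
    have h1 : ContDiffAt ℝ 1 (fun z : E × E => G z.1) (x t, deriv x t) :=
      ContDiffAt.comp (x t, deriv x t) (hG.self_of_nhds.1.of_le (by norm_num)) contDiffAt_fst
    have h2 : ContDiffAt ℝ 1 (ContinuousLinearMap.inverse :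
        (E →L[ℝ] E →L[ℝ] ℝ) → ((E →L[ℝ] ℝ) →L[ℝ] E)) (G (x t)) := by
      rw [← he]
      exact contDiffAt_map_inverse e
    exact ContDiffAt.comp (x t, deriv x t) h2 h1
  obtain ⟨K, S, hS, hlip⟩ := hVs.exists_lipschitzOnWith
  have aux : ∀ u : ℝ → E, (∀ᶠ s in 𝓝 t, ContDiffAt ℝ 2 u s) →
      (∀ᶠ s in 𝓝 t, ∀ w, deriv (fun r => G (u r) (deriv u r) w) s =
        (1 / 2 : ℝ) * fderiv ℝ (fun z => G z (deriv u s) (deriv u s)) (u s) w) →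
      u t = x t → deriv u t = deriv x t →
      ∀ᶠ s in 𝓝 t, HasDerivAt (fun r => (u r, deriv u r)) (V (u s, deriv u s)) s ∧
        (u s, deriv u s) ∈ S := by
    intro u hu hueq hu0 hu1
    have hc : ContinuousAt u t := hu.self_of_nhds.continuousAt
    have hc' : ContinuousAt (deriv u) t := by
      have h : ContDiffAt ℝ 1 (fderiv ℝ u) t := hu.self_of_nhds.fderiv_right (by norm_num)
      have : ContDiffAt ℝ 1 (deriv u) t := h.clm_apply contDiffAt_const
      exact this.continuousAt
    have hcS : Tendsto (fun s => (u s, deriv u s)) (𝓝 t) (𝓝 (x t, deriv x t)) := by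
      rw [← hu0, ← hu1]
      exact hc.prodMk hc'
    have hcG : Tendsto u (𝓝 t) (𝓝 (x t)) := by rw [← hu0]; exact hc
    filter_upwards [hu, hueq, hcS hS, hcG.eventually hG] with s h1 h2 h3 h4
    exact ⟨geodesic_hasDerivAt h4.1 h4.2 h1 h2, h3⟩
  have hsol := ODE_solution_unique_of_eventually (v := fun _ => V) (s := fun _ => S) (K := K)
    (f := fun r => (x r, deriv x r)) (g := fun r => (y r, deriv y r)) (t₀ := t)
    (Eventually.of_forall fun _ => hlip) (aux x hx hxeq rfl rfl)
    (aux y hy hyeq h0.symm h1.symm) (by simp [h0, h1])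
  filter_upwards [hsol] with s hs
  exact congrArg Prod.fst hs

/-! ### Regularity and positivity of the metric coefficients. -/

section Metric

variable {E : Type*} [NormedAddCommGroup E] [NormedSpace ℝ E]
  {M : Type*} [TopologicalSpace M] [ChartedSpace E M] [IsManifold 𝓘(ℝ, E) ∞ M]

/-- The Gram form of the metric in a chart, as a continuous bilinear form. -/
noncomputable def gramForm
    (g : Bundle.ContMDiffRiemannianMetric 𝓘(ℝ, E) ∞ E (fun x : M => TangentSpace 𝓘(ℝ, E) x))
    (e : OpenPartialHomeomorph M E) (y : E) : E →L[ℝ] E →L[ℝ] ℝ :=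
  ContinuousLinearMap.bilinearComp
    (show E →L[ℝ] E →L[ℝ] ℝ from g.inner (e.symm y))
    (show E →L[ℝ] E from mfderiv 𝓘(ℝ, E) 𝓘(ℝ, E) e.symm y)
    (show E →L[ℝ] E from mfderiv 𝓘(ℝ, E) 𝓘(ℝ, E) e.symm y)

theorem gramForm_apply
    (g : Bundle.ContMDiffRiemannianMetric 𝓘(ℝ, E) ∞ E (fun x : M => TangentSpace 𝓘(ℝ, E) x))
    (e : OpenPartialHomeomorph M E) (y v w : E) :
    gramForm g e y v w = metricInChart g e y v w := rfl

theorem gramForm_pos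
    (g : Bundle.ContMDiffRiemannianMetric 𝓘(ℝ, E) ∞ E (fun x : M => TangentSpace 𝓘(ℝ, E) x))
    {e : OpenPartialHomeomorph M E} (he : e ∈ IsManifold.maximalAtlas 𝓘(ℝ, E) ∞ M)
    {y : E} (hy : y ∈ e.target) {v : E} (hv : v ≠ 0) : 0 < gramForm g e y v v := by
  have hmd : e.MDifferentiable 𝓘(ℝ, E) 𝓘(ℝ, E) :=
    ⟨(contMDiffOn_of_mem_maximalAtlas he).mdifferentiableOn (by simp),
      (contMDiffOn_symm_of_mem_maximalAtlas he).mdifferentiableOn (by simp)⟩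
  refine g.pos (e.symm y) _ fun h0 => hv ?_
  have hinj := hmd.symm.mfderiv_injective (x := y) hy
  exact hinj (h0.trans (map_zero (mfderiv 𝓘(ℝ, E) 𝓘(ℝ, E) e.symm y)).symm)

/-- The coefficient is the smooth bundle metric evaluated on the images of two constant vector
fields under the tangent map of `e.symm`. -/
theorem contDiffOn_metricInChart
    (g : Bundle.ContMDiffRiemannianMetric 𝓘(ℝ, E) ∞ E (fun x : M => TangentSpace 𝓘(ℝ, E) x))
    {e : OpenPartialHomeomorph M E} (he : e ∈ IsManifold.maximalAtlas 𝓘(ℝ, E) ∞ M) (v w : E) :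
    ContDiffOn ℝ 2 (fun y => metricInChart g e y v w) e.target := by
  have hsymm : ContMDiffOn 𝓘(ℝ, E) 𝓘(ℝ, E) ∞ e.symm e.target :=
    contMDiffOn_symm_of_mem_maximalAtlas he
  have : IsManifold 𝓘(ℝ, E) 1 M := IsManifold.of_le (n := ∞) (by simp)
  have hvec : ∀ u : E, ContMDiffOn 𝓘(ℝ, E) (𝓘(ℝ, E).prod 𝓘(ℝ, E)) 2
      (fun y => Bundle.TotalSpace.mk' E (E := fun x : M => TangentSpace 𝓘(ℝ, E) x) (e.symm y)
        (mfderiv 𝓘(ℝ, E) 𝓘(ℝ, E) e.symm y u)) e.target := by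
    intro u
    have h1 := hsymm.contMDiffOn_tangentMapWithin (m := 2) (by norm_num; exact ENat.LEInfty.out)
      e.open_target.uniqueMDiffOn
    have h2 : ContMDiff 𝓘(ℝ, E) (𝓘(ℝ, E).prod 𝓘(ℝ, E)) 2
        (fun y : E => (⟨y, u⟩ : TangentBundle 𝓘(ℝ, E) E)) := by
      intro y
      rw [Bundle.contMDiffAt_totalSpace]
      exact ⟨contMDiffAt_id, by simpa using contMDiffAt_const⟩
    refine (h1.comp h2.contMDiffOn (fun y hy => hy)).congr fun y hy => ?_
    simp only [Function.comp, tangentMapWithin, mfderivWithin_of_isOpen e.open_target hy]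
  rw [← contMDiffOn_iff_contDiffOn]
  have h3 : ContMDiffOn 𝓘(ℝ, E) (𝓘(ℝ, E).prod 𝓘(ℝ, ℝ)) 2
      (fun y => Bundle.TotalSpace.mk' ℝ (E := Bundle.Trivial M ℝ) (e.symm y)
        (g.inner (e.symm y) (mfderiv 𝓘(ℝ, E) 𝓘(ℝ, E) e.symm y v)
          (mfderiv 𝓘(ℝ, E) 𝓘(ℝ, E) e.symm y w))) e.target := by
    apply ContMDiffOn.clm_bundle_apply₂ (F₁ := E) (F₂ := E)
    · exact ((g.contMDiff.of_le ENat.LEInfty.out).comp_contMDiffOn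
        (hsymm.of_le ENat.LEInfty.out))
    · exact hvec v
    · exact hvec w
  intro y hy
  have h4 := h3 y hy
  simp only [Bundle.contMDiffWithinAt_totalSpace] at h4
  exact h4.2

theorem contDiffAt_gramForm [FiniteDimensional ℝ E]
    (g : Bundle.ContMDiffRiemannianMetric 𝓘(ℝ, E) ∞ E (fun x : M => TangentSpace 𝓘(ℝ, E) x))
    {e : OpenPartialHomeomorph M E} (he : e ∈ IsManifold.maximalAtlas 𝓘(ℝ, E) ∞ M)
    {y : E} (hy : y ∈ e.target) : ContDiffAt ℝ 2 (gramForm g e) y := by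
  refine ContDiffOn.contDiffAt ?_ (e.open_target.mem_nhds hy)
  refine contDiffOn_clm_apply.2 fun v => contDiffOn_clm_apply.2 fun w => ?_
  exact contDiffOn_metricInChart g he v w

end Metric

theorem contDiffAt_chart_comp {E : Type*} [NormedAddCommGroup E] [NormedSpace ℝ E]
    {M : Type*} [TopologicalSpace M] [ChartedSpace E M] {e : OpenPartialHomeomorph M E}
    (he : e ∈ IsManifold.maximalAtlas 𝓘(ℝ, E) ∞ M) {c : ℝ → M}
    (hc : ContMDiff 𝓘(ℝ, ℝ) 𝓘(ℝ, E) ∞ c) {t : ℝ} (ht : c t ∈ e.source) :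
    ContDiffAt ℝ ∞ (fun r => e (c r)) t := by
  rw [← contMDiffAt_iff_contDiffAt]
  exact (contMDiffAt_of_mem_maximalAtlas he ht).comp t hc.contMDiffAt

/-! ### Uniqueness and reparametrization of geodesics. -/

section Geodesic

variable {E : Type*} [NormedAddCommGroup E] [NormedSpace ℝ E]
  {M : Type*} [TopologicalSpace M] [ChartedSpace E M] [IsManifold 𝓘(ℝ, E) ∞ M]

/-- Geodesics with the same position and the same coordinate velocity agree locally. -/
theorem IsGeodesic.eventuallyEq [FiniteDimensional ℝ E]
    {g : Bundle.ContMDiffRiemannianMetric 𝓘(ℝ, E) ∞ E (fun x : M => TangentSpace 𝓘(ℝ, E) x)}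
    {c c' : ℝ → M} (hc : IsGeodesic g c) (hc' : IsGeodesic g c') {t : ℝ}
    {e : OpenPartialHomeomorph M E} (he : e ∈ IsManifold.maximalAtlas 𝓘(ℝ, E) ∞ M)
    (ht : c t ∈ e.source) (h0 : c t = c' t)
    (h1 : deriv (fun r => e (c r)) t = deriv (fun r => e (c' r)) t) : c =ᶠ[𝓝 t] c' := by
  have ht' : c' t ∈ e.source := h0 ▸ ht
  have ev : ∀ᶠ s in 𝓝 t, c s ∈ e.source :=
    hc.1.continuous.continuousAt (e.open_source.mem_nhds ht)
  have ev' : ∀ᶠ s in 𝓝 t, c' s ∈ e.source :=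
    hc'.1.continuous.continuousAt (e.open_source.mem_nhds ht')
  have key := geodesic_coord_unique (G := gramForm g e) (x := fun r => e (c r))
    (y := fun r => e (c' r)) (t := t)
    (by
      filter_upwards [e.open_target.mem_nhds (e.map_source ht)] with z hz
      exact ⟨contDiffAt_gramForm g he hz, fun v hv => gramForm_pos g he hz hv⟩)
    (ev.mono fun s hs => (contDiffAt_chart_comp he hc.1 hs).of_le ENat.LEInfty.out)
    (ev'.mono fun s hs => (contDiffAt_chart_comp he hc'.1 hs).of_le ENat.LEInfty.out)
    (ev.mono fun s hs w => hc.2 e he s hs w)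
    (ev'.mono fun s hs w => hc'.2 e he s hs w)
    (congrArg e h0) h1
  filter_upwards [key, ev, ev'] with s hs h2 h3
  exact e.injOn h2 h3 hs

/-- A geodesic is determined by its position and velocity at one time. -/
theorem IsGeodesic.eq_of_eventuallyEq [FiniteDimensional ℝ E] [T2Space M]
    {g : Bundle.ContMDiffRiemannianMetric 𝓘(ℝ, E) ∞ E (fun x : M => TangentSpace 𝓘(ℝ, E) x)}
    {c c' : ℝ → M} (hc : IsGeodesic g c) (hc' : IsGeodesic g c') {t : ℝ}
    (h : c =ᶠ[𝓝 t] c') : c = c' := by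
  -- The set of times of local agreement is clopen: at a limit point positions and coordinate
  -- velocities agree by continuity, and local uniqueness applies.
  set A : Set ℝ := {s | c =ᶠ[𝓝 s] c'} with hA
  have hopen : IsOpen A := by
    rw [isOpen_iff_mem_nhds]
    intro s hs
    exact (eventually_eventually_nhds.2 hs)
  have hclosed : IsClosed A := by
    rw [isClosed_iff_frequently]
    intro s hs
    have h0 : c s = c' s := by
      have hcl : IsClosed {r | c r = c' r} :=
        isClosed_eq hc.1.continuous hc'.1.continuous
      exact hcl.mem_of_frequently_of_tendsto (hs.mono fun r hr => hr.self_of_nhds) tendsto_id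
    have he := IsManifold.chart_mem_maximalAtlas (I := 𝓘(ℝ, E)) (n := ∞) (c s)
    have hsrc := mem_chart_source E (c s)
    refine hc.eventuallyEq hc' he hsrc h0 ?_
    have d1 : ContinuousAt (deriv fun r => chartAt E (c s) (c r)) s := by
      have h1 : ContDiffAt ℝ 1 (fderiv ℝ fun r => chartAt E (c s) (c r)) s :=
        (contDiffAt_chart_comp he hc.1 hsrc).fderiv_right
          (by rw [one_add_one_eq_two]; exact ENat.LEInfty.out)
      exact (h1.clm_apply contDiffAt_const).continuousAt
    have d2 : ContinuousAt (deriv fun r => chartAt E (c s) (c' r)) s := by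
      have h1 : ContDiffAt ℝ 1 (fderiv ℝ fun r => chartAt E (c s) (c' r)) s :=
        (contDiffAt_chart_comp he hc'.1 (h0 ▸ hsrc)).fderiv_right
          (by rw [one_add_one_eq_two]; exact ENat.LEInfty.out)
      exact (h1.clm_apply contDiffAt_const).continuousAt
    by_contra hne
    have hne' : ∀ᶠ r in 𝓝 s, deriv (fun r => chartAt E (c s) (c r)) r ≠
        deriv (fun r => chartAt E (c s) (c' r)) r :=
      (d1.prodMk d2).eventually (isOpen_ne_fun continuous_fst continuous_snd |>.mem_nhds hne)
    obtain ⟨r, hr1, hr2⟩ := (hs.and_eventually hne').exists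
    refine hr2 (Filter.EventuallyEq.deriv_eq ?_)
    exact (show c =ᶠ[𝓝 r] c' from hr1).fun_comp _
  have huniv : A = Set.univ := IsClopen.eq_univ ⟨hclosed, hopen⟩ ⟨t, h⟩
  funext s
  have : s ∈ A := huniv ▸ Set.mem_univ s
  exact Filter.EventuallyEq.eq_of_nhds this

theorem IsGeodesic.eq_of_deriv_eq [FiniteDimensional ℝ E] [T2Space M]
    {g : Bundle.ContMDiffRiemannianMetric 𝓘(ℝ, E) ∞ E (fun x : M => TangentSpace 𝓘(ℝ, E) x)}
    {c c' : ℝ → M} (hc : IsGeodesic g c) (hc' : IsGeodesic g c') {t : ℝ}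
    {e : OpenPartialHomeomorph M E} (he : e ∈ IsManifold.maximalAtlas 𝓘(ℝ, E) ∞ M)
    (ht : c t ∈ e.source) (h0 : c t = c' t)
    (h1 : deriv (fun r => e (c r)) t = deriv (fun r => e (c' r)) t) : c = c' :=
  hc.eq_of_eventuallyEq hc' (hc.eventuallyEq hc' he ht h0 h1)

/-- Compared with `γ` by uniqueness, this shows that the velocity of `γ` never vanishes. -/
theorem isGeodesic_const
    (g : Bundle.ContMDiffRiemannianMetric 𝓘(ℝ, E) ∞ E (fun x : M => TangentSpace 𝓘(ℝ, E) x))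
    (p : M) : IsGeodesic g (fun _ : ℝ => p) := by
  refine ⟨contMDiff_const, fun e _ t _ w => ?_⟩
  simp [← gramForm_apply]

/-- Affine reparametrizations of geodesics are geodesics. -/
theorem IsGeodesic.comp_affine
    {g : Bundle.ContMDiffRiemannianMetric 𝓘(ℝ, E) ∞ E (fun x : M => TangentSpace 𝓘(ℝ, E) x)}
    {c : ℝ → M} (hc : IsGeodesic g c) (a l : ℝ) : IsGeodesic g (fun r => c (a + l * r)) := by
  refine ⟨hc.1.comp (ContDiff.contMDiff (by fun_prop)), fun e he t ht w => ?_⟩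
  have hd : ∀ (F : Type _) [NormedAddCommGroup F] [NormedSpace ℝ F] (f : ℝ → F) (s : ℝ),
      deriv (fun r => f (a + l * r)) s = l • deriv f (a + l * s) := by
    intro F _ _ f s
    rw [deriv_comp_mul_left l (fun x => f (a + x)) s, deriv_comp_const_add]
  have h := hc.2 e he (a + l * t) ht w
  have e1 : ∀ s, deriv (fun r => e (c (a + l * r))) s
      = l • deriv (fun r => e (c r)) (a + l * s) := fun s => hd E (fun r => e (c r)) s
  -- Both sides of the equation are quadratic in the velocity up to one time derivative or one
  -- velocity factor, so each acquires the factor `l ^ 2`.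
  simp only [← gramForm_apply, e1, map_smul, _root_.smul_apply, smul_eq_mul] at h ⊢
  have hf : ∀ f : E → ℝ, fderiv ℝ (fun y => l * (l * f y)) = l • l • fderiv ℝ f := by
    intro f
    rw [← fderiv_const_smul_field, ← fderiv_const_smul_field]
    rfl
  rw [deriv_const_mul_field,
    deriv_comp_mul_left l (fun x => gramForm g e (e (c (a + x)))
      (deriv (fun r => e (c r)) (a + x)) w) t,
    deriv_comp_const_add (f := fun x => gramForm g e (e (c x)) (deriv (fun r => e (c r)) x) w), h,
    hf]
  simp
  ring

end Geodesic

/-! ### Transport of geodesics and normal directions by isometries. -/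

section Action

variable {E : Type*} [NormedAddCommGroup E] [NormedSpace ℝ E]
  {M : Type*} [TopologicalSpace M] [ChartedSpace E M]

/-- The velocity of a curve in the preferred chart at a given point. -/
noncomputable def chartVelocity (p : M) (c : ℝ → M) (t : ℝ) : E :=
  deriv (fun r => chartAt E p (c r)) t

/-- The tangent space at `c t` is identified with `E` through the preferred chart there. This
replaces vectors in varying tangent spaces by vectors of the fixed space `E`. -/
theorem velocity_eq_chartVelocity {c : ℝ → M} {t : ℝ}
    (hc : MDifferentiableAt 𝓘(ℝ, ℝ) 𝓘(ℝ, E) c t) :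
    (velocity c t : E) = chartVelocity (E := E) (c t) c t := by
  simp [velocity, mfderiv, hc, chartVelocity, writtenInExtChartAt, Function.comp_def,
    chartAt_self_eq]
  rfl

theorem velocity_comp_affine {c : ℝ → M} (a l r : ℝ)
    (hc : MDifferentiableAt 𝓘(ℝ, ℝ) 𝓘(ℝ, E) c (a + l * r)) :
    (velocity (fun r => c (a + l * r)) r : E) = l • (velocity c (a + l * r) : E) := by
  have h1 : MDifferentiableAt 𝓘(ℝ, ℝ) 𝓘(ℝ, E) (fun r => c (a + l * r)) r :=
    hc.comp r (by
      rw [mdifferentiableAt_iff_differentiableAt]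
      fun_prop)
  rw [velocity_eq_chartVelocity h1, velocity_eq_chartVelocity hc]
  simp only [chartVelocity]
  rw [deriv_comp_mul_left l (fun x => chartAt E (c (a + l * r)) (c (a + x))) r,
    deriv_comp_const_add (f := fun x => chartAt E (c (a + l * r)) (c x))]
  rfl

variable {EG : Type*} [NormedAddCommGroup EG] [NormedSpace ℝ EG]
  {G : Type*} [Group G] [TopologicalSpace G] [ChartedSpace EG G] [MulAction G M]

variable (EG E) in
theorem contMDiff_smul_left [ContMDiffSMul 𝓘(ℝ, EG) 𝓘(ℝ, E) ∞ G M] (a : G) : ContMDiff 𝓘(ℝ, E) 𝓘(ℝ, E) ∞ (fun x : M => a • x) :=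
  ContMDiffSMul.contMDiff_const_smul (I := 𝓘(ℝ, EG)) a

variable (EG E) in
theorem mdifferentiable_smul_left [ContMDiffSMul 𝓘(ℝ, EG) 𝓘(ℝ, E) ∞ G M] (a : G) :
    MDifferentiable 𝓘(ℝ, E) 𝓘(ℝ, E) (fun x : M => a • x) :=
  (contMDiff_smul_left E EG a).mdifferentiable (by simp)

variable (EG E) in
theorem mdifferentiable_smul_right [ContMDiffSMul 𝓘(ℝ, EG) 𝓘(ℝ, E) ∞ G M] [LieGroup 𝓘(ℝ, EG) ∞ G] (x : M) :
    MDifferentiable 𝓘(ℝ, EG) 𝓘(ℝ, E) (fun b : G => b • x) :=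
  (ContMDiff.smul (I := 𝓘(ℝ, EG)) (n := ∞) contMDiff_id
    (contMDiff_const (c := x))).mdifferentiable (by simp)

variable (EG) in
theorem velocity_smul [ContMDiffSMul 𝓘(ℝ, EG) 𝓘(ℝ, E) ∞ G M] {c : ℝ → M} {t : ℝ} (a : G)
    (hc : MDifferentiableAt 𝓘(ℝ, ℝ) 𝓘(ℝ, E) c t) :
    velocity (fun r => a • c r) t =
      mfderiv 𝓘(ℝ, E) 𝓘(ℝ, E) (fun y : M => a • y) (c t) (velocity c t) :=
  mfderiv_comp_apply t (mdifferentiable_smul_left E EG a (c t)) hc (1 : ℝ)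

/-- A chart precomposed with the action of a group element is in the maximal atlas. -/
theorem exists_chart_comp_smul [IsManifold 𝓘(ℝ, E) ∞ M]
    [ContMDiffSMul 𝓘(ℝ, EG) 𝓘(ℝ, E) ∞ G M] (a : G) {e : OpenPartialHomeomorph M E}
    (he : e ∈ IsManifold.maximalAtlas 𝓘(ℝ, E) ∞ M) :
    ∃ e' ∈ IsManifold.maximalAtlas 𝓘(ℝ, E) ∞ M, (∀ x, e' x = e (a • x)) ∧
      (∀ x, x ∈ e'.source ↔ a • x ∈ e.source) ∧ (∀ y, e'.symm y = a⁻¹ • e.symm y) ∧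
      e'.target = e.target := by
  let Φ := Diffeomorph.smul 𝓘(ℝ, EG) 𝓘(ℝ, E) ∞ (M := M) a
  refine ⟨Φ.toHomeomorph.transOpenPartialHomeomorph e, ?_, fun _ => rfl, fun _ => Iff.rfl,
    fun y => Diffeomorph.smul_symm_apply (I := 𝓘(ℝ, EG)) (I' := 𝓘(ℝ, E)) (n := ∞) a (e.symm y),
    rfl⟩
  rw [IsManifold.mem_maximalAtlas_iff_contMDiffOn]
  constructor
  · exact (contMDiffOn_of_mem_maximalAtlas he).comp Φ.contMDiff.contMDiffOn fun x hx => hx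
  · exact Φ.symm.contMDiff.comp_contMDiffOn (contMDiffOn_symm_of_mem_maximalAtlas he)

variable (EG) in
/-- Isometries map geodesics to geodesics. -/
theorem IsGeodesic.smul [IsManifold 𝓘(ℝ, E) ∞ M]
    [ContMDiffSMul 𝓘(ℝ, EG) 𝓘(ℝ, E) ∞ G M]
    {g : Bundle.ContMDiffRiemannianMetric 𝓘(ℝ, E) ∞ E (fun x : M => TangentSpace 𝓘(ℝ, E) x)}
    (hiso : ∀ (a : G) (x : M) (v w : TangentSpace 𝓘(ℝ, E) x),
      g.inner (a • x) (mfderiv 𝓘(ℝ, E) 𝓘(ℝ, E) (fun y : M => a • y) x v)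
        (mfderiv 𝓘(ℝ, E) 𝓘(ℝ, E) (fun y : M => a • y) x w) = g.inner x v w)
    {c : ℝ → M} (hc : IsGeodesic g c) (a : G) : IsGeodesic g (fun r => a • c r) := by
  refine ⟨(contMDiff_smul_left E EG a).comp hc.1, fun e he t ht w => ?_⟩
  -- In the chart `e' = e ∘ a` the curve `c` has the coordinates that `a • c` has in `e`, and by
  -- isometry the metric coefficients coincide too.
  obtain ⟨e', he', h1, h2, h3, h4⟩ := exists_chart_comp_smul (EG := EG) a he
  have hm : ∀ y ∈ e.target, ∀ v w, metricInChart g e' y v w = metricInChart g e y v w := by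
    intro y hy v w
    have hd : MDifferentiableAt 𝓘(ℝ, E) 𝓘(ℝ, E) e.symm y :=
      ((contMDiffOn_symm_of_mem_maximalAtlas he).contMDiffAt
        (e.open_target.mem_nhds hy)).mdifferentiableAt (by simp)
    have hs : (e'.symm : E → M) = (fun x : M => a⁻¹ • x) ∘ e.symm := funext h3
    rw [metricInChart, hs]
    have hcomp : ∀ v, mfderiv 𝓘(ℝ, E) 𝓘(ℝ, E) ((fun x : M => a⁻¹ • x) ∘ e.symm) y v =
        mfderiv 𝓘(ℝ, E) 𝓘(ℝ, E) (fun x : M => a⁻¹ • x) (e.symm y)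
          (mfderiv 𝓘(ℝ, E) 𝓘(ℝ, E) e.symm y v) := fun v =>
      mfderiv_comp_apply y (mdifferentiable_smul_left E EG a⁻¹ (e.symm y)) hd v
    exact (congrArg₂ (fun p q => g.inner (a⁻¹ • e.symm y) p q) (hcomp v) (hcomp w)).trans
      (hiso a⁻¹ (e.symm y) _ _)
  have hsrc : c t ∈ e'.source := (h2 _).2 ht
  have h := hc.2 e' he' t hsrc w
  simp only [h1] at h
  have hcont : Continuous fun r => a • c r := ((contMDiff_smul_left E EG a).comp hc.1).continuous
  have ev : ∀ᶠ s in 𝓝 t, a • c s ∈ e.source :=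
    hcont.continuousAt (e.open_source.mem_nhds ht)
  have ev2 : ∀ᶠ y in 𝓝 (e (a • c t)), y ∈ e.target :=
    e.open_target.mem_nhds (e.map_source ht)
  rw [Filter.EventuallyEq.deriv_eq (f := fun s => metricInChart g e' (e (a • c s))
      (deriv (fun r => e (a • c r)) s) w)
      (ev.mono fun s hs => (hm _ (e.map_source hs) _ _).symm), h,
    Filter.EventuallyEq.fderiv_eq (f := fun y => metricInChart g e y
      (deriv (fun r => e (a • c r)) t) (deriv (fun r => e (a • c r)) t))
      (ev2.mono fun y hy => hm y hy _ _)]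

/-- Vectors tangent to the orbit of `a • x` come from vectors tangent to the orbit of `x`. -/
theorem exists_of_mem_orbitTangentSpace_smul [ContMDiffSMul 𝓘(ℝ, EG) 𝓘(ℝ, E) ∞ G M] [LieGroup 𝓘(ℝ, EG) ∞ G] (a : G) (x : M)
    {u : TangentSpace 𝓘(ℝ, E) (a • x)}
    (hu : u ∈ orbitTangentSpace (E := E) (EG := EG) G (a • x)) :
    ∃ v ∈ orbitTangentSpace (E := E) (EG := EG) G x,
      mfderiv 𝓘(ℝ, E) 𝓘(ℝ, E) (fun y : M => a • y) x v = u := by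
  obtain ⟨ξ, hξ⟩ := hu
  -- The identity `b • a • x = a • (a⁻¹ * b * a) • x` is differentiated at `b = 1`.
  have hconj : MDifferentiable 𝓘(ℝ, EG) 𝓘(ℝ, EG) (fun b : G => a⁻¹ * b * a) :=
    ((contMDiff_const.mul contMDiff_id).mul contMDiff_const :
      ContMDiff 𝓘(ℝ, EG) 𝓘(ℝ, EG) ∞ (fun b : G => a⁻¹ * b * a)).mdifferentiable (by simp)
  have hin := mfderiv_comp_apply (1 : G) (mdifferentiable_smul_right E EG x (a⁻¹ * 1 * a))
    (hconj 1) ξ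
  have hout := mfderiv_comp_apply (1 : G)
    (mdifferentiable_smul_left E EG a ((a⁻¹ * 1 * a) • x))
    ((mdifferentiable_smul_right E EG x (a⁻¹ * 1 * a)).comp 1 (hconj 1)) ξ
  have hfun : (fun y : M => a • y) ∘ ((fun b : G => b • x) ∘ fun b : G => a⁻¹ * b * a) =
      fun b : G => b • a • x := by
    funext b
    simp [smul_smul, mul_assoc]
  rw [hfun] at hout
  rw [hin] at hout
  -- The points `a⁻¹ * 1 * a` and `1`, and their actions on `x`, are only propositionally equal;
  -- freeing both variables allows substitution across the dependent tangent spaces.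
  have hgen : ∀ y : G, y = 1 → ∀ (x' : M), x' = x → ∀ η : EG,
      ∃ v ∈ orbitTangentSpace (E := E) (EG := EG) G x,
      (mfderiv 𝓘(ℝ, E) 𝓘(ℝ, E) (fun y : M => a • y) x v : E) =
      mfderiv 𝓘(ℝ, E) 𝓘(ℝ, E) (fun y : M => a • y) x'
        (show E from mfderiv 𝓘(ℝ, EG) 𝓘(ℝ, E) (fun b : G => b • x) y η) := by
    rintro _ rfl _ rfl η
    exact ⟨_, ⟨η, rfl⟩, rfl⟩
  obtain ⟨v, hv, hv'⟩ := hgen (a⁻¹ * 1 * a) (by group) ((a⁻¹ * 1 * a) • x) (by simp)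
    (mfderiv 𝓘(ℝ, EG) 𝓘(ℝ, EG) (fun b : G => a⁻¹ * b * a) 1 ξ)
  refine ⟨v, hv, hv'.trans ?_⟩
  rw [← hξ]
  exact hout.symm

theorem IsPerpToOrbitAt.smul [IsManifold 𝓘(ℝ, E) ∞ M]
    [ContMDiffSMul 𝓘(ℝ, EG) 𝓘(ℝ, E) ∞ G M] [LieGroup 𝓘(ℝ, EG) ∞ G]
    {g : Bundle.ContMDiffRiemannianMetric 𝓘(ℝ, E) ∞ E (fun x : M => TangentSpace 𝓘(ℝ, E) x)}
    (hiso : ∀ (a : G) (x : M) (v w : TangentSpace 𝓘(ℝ, E) x),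
      g.inner (a • x) (mfderiv 𝓘(ℝ, E) 𝓘(ℝ, E) (fun y : M => a • y) x v)
        (mfderiv 𝓘(ℝ, E) 𝓘(ℝ, E) (fun y : M => a • y) x w) = g.inner x v w)
    {c : ℝ → M} {t : ℝ} (hc : MDifferentiableAt 𝓘(ℝ, ℝ) 𝓘(ℝ, E) c t)
    (h : IsPerpToOrbitAt (EG := EG) G g c t) (a : G) :
    IsPerpToOrbitAt (EG := EG) G g (fun r => a • c r) t := by
  intro u hu
  obtain ⟨v, hv, rfl⟩ := exists_of_mem_orbitTangentSpace_smul a (c t) hu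
  rw [velocity_smul EG a hc]
  exact (hiso a (c t) _ _).trans (h v hv)

theorem IsPerpToOrbitAt.comp_affine [IsManifold 𝓘(ℝ, E) ∞ M]
   
    {g : Bundle.ContMDiffRiemannianMetric 𝓘(ℝ, E) ∞ E (fun x : M => TangentSpace 𝓘(ℝ, E) x)}
    {c : ℝ → M} {a l r : ℝ} (hc : MDifferentiableAt 𝓘(ℝ, ℝ) 𝓘(ℝ, E) c (a + l * r))
    (h : IsPerpToOrbitAt (EG := EG) G g c (a + l * r)) :
    IsPerpToOrbitAt (EG := EG) G g (fun r => c (a + l * r)) r := by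
  intro u hu
  rw [velocity_comp_affine a l r hc, map_smul]
  have := h u hu
  simp [this]

end Action

/-! ### First order expansion of translated curves, uniform in the group element. -/

section Expansion

variable {E : Type*} [NormedAddCommGroup E] [NormedSpace ℝ E]
  {M : Type*} [TopologicalSpace M] [ChartedSpace E M]
  {EG : Type*} [NormedAddCommGroup EG] [NormedSpace ℝ EG]
  {G : Type*} [TopologicalSpace G] [ChartedSpace EG G]

theorem contMDiffAt_chart_symm_comp [IsManifold 𝓘(ℝ, EG) ∞ G] {D : Type*} [NormedAddCommGroup D]
    [NormedSpace ℝ D] (h : G) {f : D → EG} {z : D} (hf : ContDiffAt ℝ ∞ f z)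
    (hz : f z = chartAt EG h h) :
    ContMDiffAt 𝓘(ℝ, D) 𝓘(ℝ, EG) ∞ (fun z => (chartAt EG h).symm (f z)) z := by
  have h1 : ContMDiffAt 𝓘(ℝ, EG) 𝓘(ℝ, EG) ∞ (chartAt EG h).symm (f z) :=
    contMDiffAt_symm_of_mem_maximalAtlas (IsManifold.chart_mem_maximalAtlas h)
      (hz ▸ mem_chart_target EG h)
  exact h1.comp z hf.contMDiffAt

/-- Uniform first order expansion of `s ↦ a • c s` for `a` near `h`. -/
theorem isLittleO_smul_curve [Group G] [MulAction G M] [IsManifold 𝓘(ℝ, E) ∞ M]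
    [IsManifold 𝓘(ℝ, EG) ∞ G] [ContMDiffSMul 𝓘(ℝ, EG) 𝓘(ℝ, E) ∞ G M]
    {c : ℝ → M} (hc : ContMDiff 𝓘(ℝ, ℝ) 𝓘(ℝ, E) ∞ c) {h : G} {t : ℝ} {p : M} (hp : h • c t = p) :
    (fun z : G × ℝ => chartAt E p (z.1 • c z.2) - chartAt E p (z.1 • c t) -
      (z.2 - t) • chartVelocity (E := E) p (fun s => h • c s) t) =o[𝓝 (h, t)]
    (fun z : G × ℝ => z.2 - t) := by
  set χ := chartAt EG h with hχ
  set F : EG × ℝ → E := fun z => chartAt E p (χ.symm z.1 • c z.2) with hF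
  have hFs : ContDiffAt ℝ 1 F (χ h, t) := by
    refine ContDiffAt.of_le (n := ∞) ?_ ENat.LEInfty.out
    rw [← contMDiffAt_iff_contDiffAt]
    have h1 : ContMDiffAt 𝓘(ℝ, EG × ℝ) 𝓘(ℝ, EG) ∞ (fun z : EG × ℝ => χ.symm z.1) (χ h, t) :=
      contMDiffAt_chart_symm_comp h contDiffAt_fst rfl
    have h2 : ContMDiffAt 𝓘(ℝ, EG × ℝ) 𝓘(ℝ, E) ∞ (fun z : EG × ℝ => c z.2) (χ h, t) :=
      hc.contMDiffAt.comp (χ h, t) contDiffAt_snd.contMDiffAt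
    have h3 := ContMDiffAt.smul (I := 𝓘(ℝ, EG)) h1 h2
    refine ContMDiffAt.comp (χ h, t) ?_ h3
    refine contMDiffAt_of_mem_maximalAtlas (IsManifold.chart_mem_maximalAtlas p) ?_
    simp [hχ, hp]
  -- Strict differentiability compares `(a, s)` with `(a, t)` for both moving; their difference is
  -- only `s - t`, which makes the remainder uniform in `a`.
  have hstrict := hFs.hasStrictFDerivAt (by norm_num)
  have hD : fderiv ℝ F (χ h, t) (0, 1) = chartVelocity (E := E) p (fun s => h • c s) t := by
    have h1 : HasDerivAt (fun s : ℝ => (χ h, s)) ((0 : EG), (1 : ℝ)) t :=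
      (hasDerivAt_const t (χ h)).prodMk (hasDerivAt_id t)
    have h2 := hstrict.hasFDerivAt.comp_hasDerivAt t h1
    rw [← h2.deriv, chartVelocity]
    simp [Function.comp_def, hF, hχ]
  have htend : Tendsto (fun z : G × ℝ => ((χ z.1, z.2), (χ z.1, t))) (𝓝 (h, t))
      (𝓝 ((χ h, t), (χ h, t))) := by
    have hχc : ContinuousAt χ h := χ.continuousAt (mem_chart_source EG h)
    have h1 : ContinuousAt (fun z : G × ℝ => χ z.1) (h, t) :=
      ContinuousAt.comp (g := χ) (f := Prod.fst) hχc continuousAt_fst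
    exact (h1.prodMk continuousAt_snd).prodMk (h1.prodMk continuousAt_const)
  have hlo := (hasStrictFDerivAt_iff_isLittleO.1 hstrict).comp_tendsto htend
  have hev : ∀ᶠ z : G × ℝ in 𝓝 (h, t), z.1 ∈ χ.source :=
    continuousAt_fst.eventually (χ.open_source.mem_nhds (mem_chart_source EG h))
  refine (hlo.congr' ?_ ?_).trans_isBigO (Asymptotics.isBigO_of_le _ ?_ : 
    (fun z : G × ℝ => ((0 : EG), z.2 - t)) =O[𝓝 (h, t)] fun z => z.2 - t)
  · filter_upwards [hev] with z hz
    have : ((0 : EG), z.2 - t) = (z.2 - t) • ((0 : EG), (1 : ℝ)) := by simp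
    simp only [Function.comp, hF, χ.left_inv hz, Prod.mk_sub_mk, sub_self]
    rw [this, map_smul, hD]
  · exact Eventually.of_forall fun z => by simp
  · intro z
    simp

end Expansion

/-! ### Curves in isotropy groups. -/

section Tangency

variable {E : Type*} [NormedAddCommGroup E] [NormedSpace ℝ E]
  {M : Type*} [TopologicalSpace M] [ChartedSpace E M]
  {EG : Type*} [NormedAddCommGroup EG] [NormedSpace ℝ EG] [FiniteDimensional ℝ EG]
  {G : Type*} [Group G] [TopologicalSpace G] [ChartedSpace EG G] [LieGroup 𝓘(ℝ, EG) ∞ G]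
  [MulAction G M]

/-- A vector in the kernel of the differential of the orbit map is the velocity of a curve in the
isotropy group. -/
theorem exists_curve_in_stabilizer [T2Space G] [IsManifold 𝓘(ℝ, E) ∞ M]
    [ContMDiffSMul 𝓘(ℝ, EG) 𝓘(ℝ, E) ∞ G M] (p : M) (X : EG)
    (hX : (mfderiv 𝓘(ℝ, EG) 𝓘(ℝ, E) (fun a : G => a • p) (1 : G) X : E) = 0) :
    ∃ η : ℝ → G, η 0 = 1 ∧ ContinuousAt η 0 ∧ HasDerivAt (fun r => chartAt EG (1 : G) (η r)) X 0 ∧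
      ∀ᶠ r in 𝓝 (0 : ℝ), η r • p = p := by
  have : CompleteSpace EG := FiniteDimensional.complete ℝ EG
  have : LieGroup 𝓘(ℝ, EG) (minSmoothness ℝ 3) G :=
    LieGroup.of_le (n := ∞) (by simpa using ENat.LEInfty.out)
  have : ContinuousSMul G M := ContMDiffSMul.continuousSMul (I := 𝓘(ℝ, EG)) (I' := 𝓘(ℝ, E)) ∞
  have : IsManifold 𝓘(ℝ, EG) 1 G := IsManifold.of_le (n := ∞) (by simp)
  -- `η` is an integral curve of the left-invariant field of `X`. The orbit map is equivariant, so
  -- its differential kills this field everywhere and `η r • p` is locally constant.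
  obtain ⟨η, hη0, hη⟩ := exists_isMIntegralCurveAt_of_contMDiffAt_boundaryless
    (I := 𝓘(ℝ, EG)) (x₀ := (1 : G)) (t₀ := (0 : ℝ)) (v := mulInvariantVectorField (I := 𝓘(ℝ, EG)) X)
    ((contMDiffAt_mulInvariantVectorField (I := 𝓘(ℝ, EG)) X).of_le (by simp))
  have hcont : ContinuousAt η 0 := hη.continuousAt
  have hV1 : ∀ y : G, y = 1 → (mulInvariantVectorField (I := 𝓘(ℝ, EG)) X y : EG) = X := by
    rintro _ rfl
    have h1 : (fun b : G => 1 * b) = id := by ext; simp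
    exact (congrArg (fun f : G → G => (mfderiv 𝓘(ℝ, EG) 𝓘(ℝ, EG) f 1 X : EG)) h1).trans
      (DFunLike.congr_fun (mfderiv_id (I := 𝓘(ℝ, EG)) (x := (1 : G))) X)
  refine ⟨η, hη0, hcont, ?_, ?_⟩
  · have h1 := hη.hasMFDerivAt
    have h2 := velocity_eq_chartVelocity h1.mdifferentiableAt
    have h3 : (velocity (E := EG) η 0 : EG) = X := by
      have h5 : (velocity (E := EG) η 0 : EG) =
          (1 : ℝ) • (mulInvariantVectorField (I := 𝓘(ℝ, EG)) X (η 0) : EG) :=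
        congrArg (fun L : ℝ →L[ℝ] EG => L 1) h1.mfderiv
      rw [h5, one_smul, hV1 (η 0) hη0]
    rw [h3, chartVelocity, hη0] at h2
    have h4 : DifferentiableAt ℝ (fun r => chartAt EG (1 : G) (η r)) 0 := by
      have h5 : MDifferentiableAt 𝓘(ℝ, EG) 𝓘(ℝ, EG) (chartAt EG (1 : G)) (η 0) :=
        mdifferentiableAt_atlas (chart_mem_atlas EG (1 : G)) (hη0 ▸ mem_chart_source EG (1 : G))
      exact mdifferentiableAt_iff_differentiableAt.1 (h5.comp 0 h1.mdifferentiableAt)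
    rw [h2]
    exact h4.hasDerivAt
  · have hcurve : ∀ᶠ r in 𝓝 (0 : ℝ),
        HasMFDerivAt 𝓘(ℝ, ℝ) 𝓘(ℝ, E) (fun r => η r • p) r 0 := by
      filter_upwards [hη] with r hr
      have ho := (mdifferentiable_smul_right E EG p (η r)).hasMFDerivAt.comp r hr
      have hz : (mfderiv 𝓘(ℝ, EG) 𝓘(ℝ, E) (fun b : G => b • p) (η r)
          (mulInvariantVectorField (I := 𝓘(ℝ, EG)) X (η r)) : E) = 0 := by
        have hl : MDifferentiableAt 𝓘(ℝ, EG) 𝓘(ℝ, EG) (fun b : G => η r * b) 1 :=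
          (contMDiff_mul_left (I := 𝓘(ℝ, EG)) (n := ∞)).mdifferentiable (by simp) 1
        have e1 := mfderiv_comp_apply_of_eq (x := (1 : G)) (y := η r)
          (mdifferentiable_smul_right E EG p (η r)) hl (mul_one _) X
        have e2 := mfderiv_comp_apply (1 : G)
          (mdifferentiable_smul_left E EG (η r) ((1 : G) • p))
          (mdifferentiable_smul_right E EG p 1) X
        have e3 : (fun b : G => b • p) ∘ (fun b : G => η r * b) =
            (fun y : M => η r • y) ∘ fun b : G => b • p := by
          funext b
          simp [mul_smul]
        have e4 : (mfderiv 𝓘(ℝ, EG) 𝓘(ℝ, E)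
              ((fun b : G => b • p) ∘ fun b : G => η r * b) 1 X : E) =
            mfderiv 𝓘(ℝ, EG) 𝓘(ℝ, E) ((fun y : M => η r • y) ∘ fun b : G => b • p) 1 X :=
          congrArg (fun f : G → M => (mfderiv 𝓘(ℝ, EG) 𝓘(ℝ, E) f 1 X : E)) e3
        have e5 : (mfderiv 𝓘(ℝ, E) 𝓘(ℝ, E) (fun y : M => η r • y) ((1 : G) • p)
            (mfderiv 𝓘(ℝ, EG) 𝓘(ℝ, E) (fun b : G => b • p) 1 X) : E) = 0 :=
          (congrArg (fun v : E => (mfderiv 𝓘(ℝ, E) 𝓘(ℝ, E) (fun y : M => η r • y)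
            ((1 : G) • p) v : E)) hX).trans
            (map_zero (mfderiv 𝓘(ℝ, E) 𝓘(ℝ, E) (fun y : M => η r • y) ((1 : G) • p)))
        exact e1.symm.trans (e4.trans (e2.trans e5))
      refine ho.congr_mfderiv ?_
      refine ContinuousLinearMap.ext fun s : ℝ => ?_
      have e6 := map_smul (mfderiv 𝓘(ℝ, EG) 𝓘(ℝ, E) (fun b : G => b • p) (η r)) s
        (mulInvariantVectorField (I := 𝓘(ℝ, EG)) X (η r))
      have e7 : s • (0 : E) = 0 := smul_zero s
      exact e6.trans ((congrArg (fun v : E => s • v) hz).trans e7)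
    have hc0 : ContinuousAt (fun r => η r • p) 0 := hcont.smul continuousAt_const
    have hsrc : ∀ᶠ r in 𝓝 (0 : ℝ), η r • p ∈ (chartAt E p).source :=
      hc0.eventually ((chartAt E p).open_source.mem_nhds
        (by simp [hη0]))
    obtain ⟨δ, hδ, hball⟩ := Metric.eventually_nhds_iff_ball.1 (hcurve.and hsrc)
    have hder : ∀ r ∈ Metric.ball (0 : ℝ) δ,
        HasDerivAt (fun r => chartAt E p (η r • p)) 0 r := by
      intro r hr
      obtain ⟨h1, h2⟩ := hball r hr
      have h3 := (mdifferentiableAt_atlas (I := 𝓘(ℝ, E)) (chart_mem_atlas E p)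
        h2).hasMFDerivAt.comp r h1
      have h4 : HasFDerivAt (fun r => chartAt E p (η r • p)) (0 : ℝ →L[ℝ] E) r := by
        exact (h3.congr_mfderiv (ContinuousLinearMap.comp_zero _)).hasFDerivAt
      simpa using h4.hasDerivAt
    filter_upwards [Metric.ball_mem_nhds (0 : ℝ) hδ] with r hr
    refine (chartAt E p).injOn (hball r hr).2 (mem_chart_source E p) ?_
    have h5 := Metric.isOpen_ball.is_const_of_deriv_eq_zero
      (convex_ball (0 : ℝ) δ).isPreconnected
      (fun r hr => (hder r hr).differentiableAt.differentiableWithinAt)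
      (fun r hr => (hder r hr).deriv) hr (Metric.mem_ball_self hδ)
    simpa [hη0] using h5

end Tangency

/-! ### Orbits are tangent to their tangent spaces. -/

section Tangency

variable {E : Type*} [NormedAddCommGroup E] [NormedSpace ℝ E]
  {M : Type*} [TopologicalSpace M] [ChartedSpace E M]
  {EG : Type*} [NormedAddCommGroup EG] [NormedSpace ℝ EG]
  {G : Type*} [Group G] [TopologicalSpace G] [ChartedSpace EG G]

theorem tendsto_norm_inv_smul {α A B : Type*} [NormedAddCommGroup A] [NormedSpace ℝ A]
    [NormedAddCommGroup B] {r : α → A} {x : α → B} {F : Filter α} (h : r =o[F] x) :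
    Tendsto (fun u => ‖x u‖⁻¹ • r u) F (𝓝 0) :=
  (Asymptotics.isLittleO_norm_right.2 h).tendsto_inv_smul_nhds_zero

/-- First order expansion, in the chart at `1`, of `(x, r) ↦ x * η r` for a curve `η` through
`1`. -/
theorem hasFDerivAt_mul_curve [LieGroup 𝓘(ℝ, EG) ∞ G] {η : ℝ → G} {X : EG} (h0 : η 0 = 1)
    (hc : ContinuousAt η 0) (hη : HasDerivAt (fun r => chartAt EG (1 : G) (η r)) X 0) :
    HasFDerivAt (fun z : EG × ℝ => chartAt EG (1 : G) ((chartAt EG (1 : G)).symm z.1 * η z.2))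
      (ContinuousLinearMap.fst ℝ EG ℝ + (ContinuousLinearMap.snd ℝ EG ℝ).smulRight X)
      (chartAt EG (1 : G) 1, 0) := by
  set χ := chartAt EG (1 : G) with hχ
  have hsrc : (1 : G) ∈ χ.source := mem_chart_source EG (1 : G)
  set m : EG × EG → EG := fun z => χ (χ.symm z.1 * χ.symm z.2) with hm
  have hms : ContDiffAt ℝ ∞ m (χ 1, χ 1) := by
    rw [← contMDiffAt_iff_contDiffAt]
    have h1 : ContMDiffAt 𝓘(ℝ, EG × EG) 𝓘(ℝ, EG) ∞ (fun z : EG × EG => χ.symm z.1) (χ 1, χ 1) :=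
      contMDiffAt_chart_symm_comp (1 : G) contDiffAt_fst rfl
    have h2 : ContMDiffAt 𝓘(ℝ, EG × EG) 𝓘(ℝ, EG) ∞ (fun z : EG × EG => χ.symm z.2) (χ 1, χ 1) :=
      contMDiffAt_chart_symm_comp (1 : G) contDiffAt_snd rfl
    refine ContMDiffAt.comp (χ 1, χ 1) ?_ (h1.mul h2)
    refine contMDiffAt_of_mem_maximalAtlas (IsManifold.chart_mem_maximalAtlas (1 : G)) ?_
    simp [hχ]
  have hmd := (hms.differentiableAt (by simp)).hasFDerivAt
  set D := fderiv ℝ m (χ 1, χ 1) with hD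
  -- Multiplying by `1` on either side is the identity, so the differential of multiplication at
  -- `(1, 1)` is addition.
  have hfst : ∀ v : EG, D (v, 0) = v := by
    intro v
    have h1 : HasFDerivAt (fun x : EG => (x, χ 1)) ((ContinuousLinearMap.id ℝ EG).prod 0) (χ 1) :=
      (hasFDerivAt_id _).prodMk (hasFDerivAt_const _ _)
    have h2 := HasFDerivAt.comp (g := m) (f := fun x : EG => (x, χ 1)) (χ 1) hmd h1
    have h3 : HasFDerivAt (m ∘ fun x : EG => (x, χ 1)) (ContinuousLinearMap.id ℝ EG) (χ 1) := by
      refine (hasFDerivAt_id (χ 1)).congr_of_eventuallyEq ?_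
      filter_upwards [χ.open_target.mem_nhds (χ.map_source hsrc)] with x hx
      simp [hm, χ.left_inv hsrc, χ.right_inv hx]
    simpa using DFunLike.congr_fun (h2.unique h3) v
  have hsnd : ∀ v : EG, D (0, v) = v := by
    intro v
    have h1 : HasFDerivAt (fun x : EG => (χ 1, x)) ((0 : EG →L[ℝ] EG).prod
        (ContinuousLinearMap.id ℝ EG)) (χ 1) :=
      (hasFDerivAt_const _ _).prodMk (hasFDerivAt_id _)
    have h2 := HasFDerivAt.comp (g := m) (f := fun x : EG => (χ 1, x)) (χ 1) hmd h1
    have h3 : HasFDerivAt (m ∘ fun x : EG => (χ 1, x)) (ContinuousLinearMap.id ℝ EG) (χ 1) := by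
      refine (hasFDerivAt_id (χ 1)).congr_of_eventuallyEq ?_
      filter_upwards [χ.open_target.mem_nhds (χ.map_source hsrc)] with x hx
      simp [hm, χ.left_inv hsrc, χ.right_inv hx]
    simpa using DFunLike.congr_fun (h2.unique h3) v
  have hin : HasFDerivAt (fun z : EG × ℝ => (z.1, χ (η z.2)))
      ((ContinuousLinearMap.fst ℝ EG ℝ).prod ((ContinuousLinearMap.snd ℝ EG ℝ).smulRight X))
      (χ 1, 0) := by
    refine hasFDerivAt_fst.prodMk ?_
    have := hη.hasFDerivAt.comp (χ 1, (0 : ℝ)) (hasFDerivAt_snd (𝕜 := ℝ) (p := (χ 1, (0 : ℝ))))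
    refine this.congr_fderiv ?_
    ext <;> simp
  have hcomp := HasFDerivAt.comp (g := m) (χ 1, (0 : ℝ)) (by simpa [h0] using hmd) hin
  refine (hcomp.congr_of_eventuallyEq ?_).congr_fderiv ?_
  · have hev : ∀ᶠ z : EG × ℝ in 𝓝 (χ 1, 0), η z.2 ∈ χ.source := by
      have h1 : Tendsto (fun z : EG × ℝ => η z.2) (𝓝 (χ 1, 0)) (𝓝 (η 0)) :=
        ContinuousAt.comp (g := η) (f := Prod.snd) (x := (χ 1, (0 : ℝ))) hc continuousAt_snd
      exact h1.eventually (χ.open_source.mem_nhds (by rwa [h0]))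
    filter_upwards [hev] with z hz
    simp [hm, χ.left_inv hz]
  · refine ContinuousLinearMap.ext fun z => ?_
    have : D (z.1, z.2 • X) = D (z.1, 0) + D (0, z.2 • X) := by
      rw [← map_add]; simp
    simpa [hfst, hsnd] using this

/-- The orbit map in charts is differentiable at the identity, with differential the manifold
differential. -/
theorem hasFDerivAt_orbit_chart [MulAction G M] [LieGroup 𝓘(ℝ, EG) ∞ G]
    [ContMDiffSMul 𝓘(ℝ, EG) 𝓘(ℝ, E) ∞ G M] (p : M) :
    HasFDerivAt (fun x : EG => chartAt E p ((chartAt EG (1 : G)).symm x • p))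
      (mfderiv 𝓘(ℝ, EG) 𝓘(ℝ, E) (fun a : G => a • p) (1 : G) : EG →L[ℝ] E)
      (chartAt EG (1 : G) 1) := by
  have h := (mdifferentiable_smul_right E EG p (1 : G)).hasMFDerivAt.2
  simp only [writtenInExtChartAt, one_smul] at h
  have h' : HasFDerivWithinAt (fun x : EG => chartAt E p ((chartAt EG (1 : G)).symm x • p))
      (mfderiv 𝓘(ℝ, EG) 𝓘(ℝ, E) (fun a : G => a • p) (1 : G) : EG →L[ℝ] E) Set.univ
      (chartAt EG (1 : G) 1) := by
    simpa [Function.comp_def] using h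
  exact hasFDerivWithinAt_univ.1 h'

/-- The orbit of `p` is tangent to its tangent space: displacements along the orbit are, to first
order, tangential. -/
theorem isLittleO_normal_displacement [MulAction G M] [IsManifold 𝓘(ℝ, E) ∞ M]
    [FiniteDimensional ℝ EG] [T2Space M] [T2Space G] [LieGroup 𝓘(ℝ, EG) ∞ G]
    [ContMDiffSMul 𝓘(ℝ, EG) 𝓘(ℝ, E) ∞ G M] (p : M) (l : E →L[ℝ] ℝ)
    (hl : ∀ X : EG, l (mfderiv 𝓘(ℝ, EG) 𝓘(ℝ, E) (fun a : G => a • p) (1 : G) X : E) = 0) :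
    (fun u : G => l (chartAt E p (u • p) - chartAt E p p)) =o[𝓝 (1 : G)]
      (fun u : G => chartAt E p (u • p) - chartAt E p p) := by
  have : ContinuousSMul G M := ContMDiffSMul.continuousSMul (I := 𝓘(ℝ, EG)) (I' := 𝓘(ℝ, E)) ∞
  have : ProperSpace EG := FiniteDimensional.proper ℝ EG
  have : IsTopologicalGroup G := topologicalGroup_of_lieGroup 𝓘(ℝ, EG) ∞
  set χ := chartAt EG (1 : G) with hχ
  set L : EG →L[ℝ] E := mfderiv 𝓘(ℝ, EG) 𝓘(ℝ, E) (fun a : G => a • p) (1 : G) with hL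
  have hsrc : (1 : G) ∈ χ.source := mem_chart_source EG (1 : G)
  obtain ⟨ε, hε, hball⟩ := Metric.nhds_basis_closedBall.mem_iff.1
    (χ.open_target.mem_nhds (χ.map_source hsrc))
  set B : Set G := χ.symm '' Metric.closedBall (χ 1) ε with hB
  have hBc : IsCompact B := (isCompact_closedBall _ _).image_of_continuousOn
    (χ.continuousOn_symm.mono hball)
  have hBsrc : B ⊆ χ.source := by
    rintro _ ⟨x, hx, rfl⟩
    exact χ.map_target (hball hx)
  have hBnhds : B ∈ 𝓝 (1 : G) := by
    have h1 : ∀ᶠ y in 𝓝 (1 : G), χ y ∈ Metric.closedBall (χ 1) ε :=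
      (χ.continuousAt hsrc).eventually (Metric.closedBall_mem_nhds _ hε)
    filter_upwards [h1, χ.open_source.mem_nhds hsrc] with y hy hy'
    exact ⟨χ y, hy, χ.left_inv hy'⟩
  -- The orbit map need not be injective near `1`, so `u` is replaced by the representative of `u •
  -- p` in `B` closest to `1` in the chart.
  have hmin : ∀ u : G, ∃ y : G, u ∈ B → y ∈ B ∧ y • p = u • p ∧
      ∀ y' ∈ B, y' • p = u • p → ‖χ y - χ 1‖ ≤ ‖χ y' - χ 1‖ := by
    intro u
    by_cases hu : u ∈ B
    · have hcomp : IsCompact (B ∩ {y | y • p = u • p}) :=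
        hBc.inter_right (isClosed_eq (continuous_id.smul continuous_const) continuous_const)
      obtain ⟨y, hy, hymin⟩ := hcomp.exists_isMinOn ⟨u, hu, rfl⟩
        (f := fun y => ‖χ y - χ 1‖)
        (((χ.continuousOn.mono hBsrc).mono Set.inter_subset_left).sub continuousOn_const).norm
      exact ⟨y, fun _ => ⟨hy.1, hy.2, fun y' h1 h2 => hymin ⟨h1, h2⟩⟩⟩
    · exact ⟨1, fun h => absurd h hu⟩
  choose m hm using hmin
  rw [Asymptotics.isLittleO_iff]
  intro κ hκ
  by_contra hcon
  rw [Filter.not_eventually] at hcon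
  set bad : Set G := {u | ¬ ‖l (chartAt E p (u • p) - chartAt E p p)‖ ≤
    κ * ‖chartAt E p (u • p) - chartAt E p p‖} with hbad
  have hne : (𝓝 (1 : G) ⊓ 𝓟 bad).NeBot := by
    rw [← Filter.frequently_mem_iff_neBot]
    exact hcon
  set U : Ultrafilter G := Ultrafilter.of (𝓝 (1 : G) ⊓ 𝓟 bad) with hU
  have hUle : (U : Filter G) ≤ 𝓝 1 ⊓ 𝓟 bad := Ultrafilter.of_le _
  have hU1 : (U : Filter G) ≤ 𝓝 1 := hUle.trans inf_le_left
  have hUbad : ∀ᶠ u in (U : Filter G), u ∈ bad := hUle.trans inf_le_right (mem_principal_self _)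
  have hUB : ∀ᶠ u in (U : Filter G), u ∈ B := hU1 hBnhds
  set x : G → EG := fun u => χ (m u) - χ 1 with hx
  set d : G → E := fun u => chartAt E p (u • p) - chartAt E p p with hd
  have hx0 : Tendsto x U (𝓝 0) := by
    have h1 : Tendsto (fun u => χ u - χ 1) U (𝓝 0) := by
      have := ((χ.continuousAt hsrc).tendsto.mono_left hU1).sub_const (χ 1)
      simpa using this
    refine squeeze_zero_norm' ?_ (tendsto_zero_iff_norm_tendsto_zero.1 h1)
    filter_upwards [hUB] with u hu
    exact (hm u hu).2.2 u hu rfl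
  have hdx : ∀ u ∈ B, d u = chartAt E p (χ.symm (χ 1 + x u) • p) -
      chartAt E p (χ.symm (χ 1) • p) := by
    intro u hu
    simp only [hd, hx, add_sub_cancel, χ.left_inv (hBsrc (hm u hu).1), χ.left_inv hsrc, one_smul,
      (hm u hu).2.1]
  have hlo : (fun u => d u - L (x u)) =o[(U : Filter G)] x := by
    have h1 := (hasFDerivAt_iff_isLittleO_nhds_zero.1
      (hasFDerivAt_orbit_chart (E := E) (EG := EG) (G := G) p)).comp_tendsto hx0
    refine h1.congr' ?_ (Eventually.of_forall fun _ => rfl)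
    filter_upwards [hUB] with u hu
    simp only [Function.comp, hdx u hu]
    rfl
  have hxne : ∀ᶠ u in (U : Filter G), x u ≠ 0 := by
    filter_upwards [hUB, hUbad] with u hu hub h0
    refine hub ?_
    have : d u = 0 := by simp [hdx u hu, h0]
    simp only [hd] at this
    simp [this]
  set w : G → EG := fun u => ‖x u‖⁻¹ • x u with hw
  obtain ⟨X, hXs, hX⟩ := (isCompact_sphere (0 : EG) 1).ultrafilter_le_nhds (U.map w) (by
    rw [le_principal_iff, Ultrafilter.mem_coe, Ultrafilter.mem_map]
    filter_upwards [hxne] with u hu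
    simp [hw, norm_smul, hu])
  have hwX : Tendsto w U (𝓝 X) := hX
  have hdlim : Tendsto (fun u => ‖x u‖⁻¹ • d u) U (𝓝 (L X)) := by
    have h1 := (tendsto_norm_inv_smul hlo).add ((L.continuous.tendsto X).comp hwX)
    rw [zero_add] at h1
    refine h1.congr fun u => ?_
    simp [hw, smul_sub]
  -- `X` is the limit direction of the minimal representatives. Badness passes to the limit as `κ *
  -- ‖L X‖ ≤ ‖l (L X)‖ = 0`.
  have hLX : L X = 0 := by
    have h1 : Tendsto (fun u => κ * ‖‖x u‖⁻¹ • d u‖) U (𝓝 (κ * ‖L X‖)) :=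
      hdlim.norm.const_mul κ
    have h2 : Tendsto (fun u => ‖l (‖x u‖⁻¹ • d u)‖) U (𝓝 ‖l (L X)‖) :=
      ((l.continuous.tendsto _).comp hdlim).norm
    have h3 : κ * ‖L X‖ ≤ ‖l (L X)‖ := by
      refine le_of_tendsto_of_tendsto h1 h2 ?_
      filter_upwards [hUbad] with u hu
      have h4 : κ * ‖d u‖ ≤ ‖l (d u)‖ := (not_le.1 hu).le
      have h5 : 0 ≤ ‖x u‖⁻¹ := by positivity
      simp only [map_smul, norm_smul, norm_inv, norm_norm]
      calc κ * (‖x u‖⁻¹ * ‖d u‖) = ‖x u‖⁻¹ * (κ * ‖d u‖) := by ring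
        _ ≤ _ := mul_le_mul_of_nonneg_left h4 h5
    have h6 : ‖l (L X)‖ = 0 := norm_eq_zero.2 (hl X)
    rw [h6] at h3
    have : ‖L X‖ ≤ 0 := by
      by_contra hpos
      exact absurd h3 (not_le.2 (mul_pos hκ (not_le.1 hpos)))
    exact norm_le_zero_iff.1 this
  obtain ⟨η, hη0, hηc, hηd, hηp⟩ := exists_curve_in_stabilizer (E := E) p X hLX
  have hs0 : Tendsto (fun u => (x u, -‖x u‖)) U (𝓝 0) := by
    have := hx0.prodMk_nhds (hx0.norm.neg)
    rwa [norm_zero, neg_zero] at this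
  have hlo2 := (hasFDerivAt_iff_isLittleO_nhds_zero.1
    (hasFDerivAt_mul_curve hη0 hηc hηd)).comp_tendsto hs0
  -- Right multiplication by `η (-‖x u‖)` keeps the point `u • p` but cancels the leading term `‖x
  -- u‖ • X`. The new representative is at distance `o(‖x u‖)` from `1`, contradicting minimality.
  have hy : (fun u => χ (m u * η (-‖x u‖)) - χ 1 - (x u - ‖x u‖ • X)) =o[(U : Filter G)] x := by
    refine (hlo2.congr' ?_ (Eventually.of_forall fun _ => rfl)).trans_isBigO
      (Asymptotics.isBigO_of_le _ fun u => ?_)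
    · filter_upwards [hUB] with u hu
      simp only [Function.comp, Prod.mk_add_mk, zero_add, ← hχ, hx, add_sub_cancel,
        χ.left_inv (hBsrc (hm u hu).1), χ.left_inv hsrc, hη0, mul_one]
      simp [sub_eq_add_neg]
    · simp
  have hmu : Tendsto m U (𝓝 1) := by
    have h1 : Tendsto (fun u => χ.symm (χ 1 + x u)) U (𝓝 (χ.symm (χ 1))) := by
      have h2 : Tendsto (fun u => χ 1 + x u) U (𝓝 (χ 1)) := by
        simpa using hx0.const_add (χ 1)
      exact (χ.continuousAt_symm (χ.map_source hsrc)).tendsto.comp h2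
    rw [χ.left_inv hsrc] at h1
    refine h1.congr' ?_
    filter_upwards [hUB] with u hu
    simp only [hx, add_sub_cancel, χ.left_inv (hBsrc (hm u hu).1)]
  have hneg : Tendsto (fun u => -‖x u‖) U (𝓝 0) := by simpa using hx0.norm.neg
  have hyB : ∀ᶠ u in (U : Filter G), m u * η (-‖x u‖) ∈ B := by
    have h1 : Tendsto (fun u => m u * η (-‖x u‖)) U (𝓝 (1 * 1)) :=
      hmu.mul (hη0 ▸ hηc.tendsto.comp hneg)
    rw [mul_one] at h1
    exact h1.eventually hBnhds
  have hone : ∀ᶠ u in (U : Filter G), (1 : ℝ) ≤ ‖‖x u‖⁻¹ • (χ (m u * η (-‖x u‖)) - χ 1)‖ := by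
    filter_upwards [hUB, hyB, hneg.eventually hηp, hxne] with u hu huB hup hne
    have h1 : (m u * η (-‖x u‖)) • p = u • p := by rw [mul_smul, hup, (hm u hu).2.1]
    have h2 : ‖x u‖ ≤ ‖χ (m u * η (-‖x u‖)) - χ 1‖ := (hm u hu).2.2 _ huB h1
    have h3 : 0 < ‖x u‖ := norm_pos_iff.2 hne
    rw [norm_smul, norm_inv, norm_norm, ← div_eq_inv_mul]
    exact (one_le_div h3).2 h2
  have hzero : Tendsto (fun u => ‖x u‖⁻¹ • (χ (m u * η (-‖x u‖)) - χ 1)) U (𝓝 0) := by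
    have h1 := (tendsto_norm_inv_smul hy).add (hwX.sub_const X)
    rw [sub_self, add_zero] at h1
    refine h1.congr' ?_
    filter_upwards [hxne] with u hne
    have h3 : ‖x u‖ ≠ 0 := norm_ne_zero_iff.2 hne
    simp only [hw, smul_sub, smul_smul, inv_mul_cancel₀ h3, one_smul]
    abel
  have h1 : (1 : ℝ) ≤ ‖(0 : EG)‖ := ge_of_tendsto hzero.norm hone
  norm_num at h1

end Tangency

/-! ### Normal vectors are multiples of velocities of translates of `γ`. -/

section Transitivity

variable {E : Type*} [NormedAddCommGroup E] [NormedSpace ℝ E]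
  {M : Type*} [TopologicalSpace M] [ChartedSpace E M] [IsManifold 𝓘(ℝ, E) ∞ M]
  {g : Bundle.ContMDiffRiemannianMetric 𝓘(ℝ, E) ∞ E (fun x : M => TangentSpace 𝓘(ℝ, E) x)}
  {EG : Type*} [NormedAddCommGroup EG] [NormedSpace ℝ EG]
  {G : Type*} [Group G] [TopologicalSpace G] [ChartedSpace EG G] [MulAction G M]

/-- The metric at a point as a bilinear form on the model space. -/
noncomputable def metricAt
    (g : Bundle.ContMDiffRiemannianMetric 𝓘(ℝ, E) ∞ E (fun x : M => TangentSpace 𝓘(ℝ, E) x))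
    (p : M) : E →L[ℝ] E →L[ℝ] ℝ := g.inner p

theorem metricAt_pos (p : M) {v : E} (hv : v ≠ 0) : 0 < metricAt g p v v := g.pos p v hv

variable (g EG G) in
/-- The vector `v` is normal to the orbit of `p`. -/
def IsNormalToOrbit (p : M) (v : E) : Prop :=
  ∀ X : EG, metricAt g p v
    (mfderiv 𝓘(ℝ, EG) 𝓘(ℝ, E) (fun a : G => a • p) (1 : G) X : E) = 0

theorem IsNormalToOrbit.sub_smul {p : M} {v w : E} (hv : IsNormalToOrbit g EG G p v)
    (hw : IsNormalToOrbit g EG G p w) (a : ℝ) : IsNormalToOrbit g EG G p (v - a • w) := by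
  intro X
  have h : ∀ u : E, metricAt g p (v - a • w) u = metricAt g p v u - a * metricAt g p w u :=
    fun u => by simp
  exact (h _).trans ((congrArg₂ (fun x y : ℝ => x - a * y) (hv X) (hw X)).trans (by simp))

theorem isPerpToOrbitAt_iff_isNormalToOrbit {c : ℝ → M} {t : ℝ} {p : M} (hp : c t = p)
    (hc : MDifferentiableAt 𝓘(ℝ, ℝ) 𝓘(ℝ, E) c t) :
    IsPerpToOrbitAt (EG := EG) G g c t ↔ IsNormalToOrbit g EG G p (chartVelocity p c t) := by
  subst hp
  have h1 := velocity_eq_chartVelocity hc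
  constructor
  · intro h X
    have := h _ ⟨X, rfl⟩
    rw [← h1]
    exact this
  · rintro h u ⟨X, rfl⟩
    have := h X
    rw [← h1] at this
    exact this

theorem metricAt_chartVelocity {c : ℝ → M} {t : ℝ} {p : M} (hp : c t = p)
    (hc : MDifferentiableAt 𝓘(ℝ, ℝ) 𝓘(ℝ, E) c t) :
    metricAt g p (chartVelocity p c t) (chartVelocity p c t) =
      g.inner (c t) (velocity c t) (velocity c t) := by
  subst hp
  rw [← velocity_eq_chartVelocity hc]
  rfl

theorem metricAt_chartVelocity_smul [ContMDiffSMul 𝓘(ℝ, EG) 𝓘(ℝ, E) ∞ G M]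
    (hiso : ∀ (a : G) (x : M) (v w : TangentSpace 𝓘(ℝ, E) x),
      g.inner (a • x) (mfderiv 𝓘(ℝ, E) 𝓘(ℝ, E) (fun y : M => a • y) x v)
        (mfderiv 𝓘(ℝ, E) 𝓘(ℝ, E) (fun y : M => a • y) x w) = g.inner x v w)
    {c : ℝ → M} {t : ℝ} {p : M} {k : G} (hp : k • c t = p)
    (hc : MDifferentiableAt 𝓘(ℝ, ℝ) 𝓘(ℝ, E) c t) :
    metricAt g p (chartVelocity p (fun s => k • c s) t) (chartVelocity p (fun s => k • c s) t) =
      g.inner (c t) (velocity c t) (velocity c t) := by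
  have hkc : MDifferentiableAt 𝓘(ℝ, ℝ) 𝓘(ℝ, E) (fun s => k • c s) t :=
    (mdifferentiable_smul_left E EG k (c t)).comp t hc
  rw [metricAt_chartVelocity (c := fun s => k • c s) hp hkc, velocity_smul EG k hc]
  exact hiso k (c t) _ _

/-- Let `c` meet the orbit of `γ t` perpendicularly, and let it stay in the orbits of the points
of the curve `γ`. Then, up to scaling, the velocity of `c` is the image of the velocity of `γ` under
an element of the isotropy group. -/
theorem exists_eq_smul_chartVelocity [ContMDiffSMul 𝓘(ℝ, EG) 𝓘(ℝ, E) ∞ G M]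
    [FiniteDimensional ℝ EG] [T2Space M] [T2Space G] [CompactSpace G] [LieGroup 𝓘(ℝ, EG) ∞ G]
    (hiso : ∀ (a : G) (x : M) (v w : TangentSpace 𝓘(ℝ, E) x),
      g.inner (a • x) (mfderiv 𝓘(ℝ, E) 𝓘(ℝ, E) (fun y : M => a • y) x v)
        (mfderiv 𝓘(ℝ, E) 𝓘(ℝ, E) (fun y : M => a • y) x w) = g.inner x v w)
    {γ : ℝ → M} (hγ : ContMDiff 𝓘(ℝ, ℝ) 𝓘(ℝ, E) ∞ γ) {t : ℝ} {p : M} (hp : γ t = p)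
    (hperp : IsPerpToOrbitAt (EG := EG) G g γ t) (hvel : (velocity γ t : E) ≠ 0)
    {c : ℝ → M} {v : E} (hc0 : c 0 = p) (hcc : ContinuousAt c 0)
    (hcv : HasDerivAt (fun r => chartAt E p (c r)) v 0) (hv : IsNormalToOrbit g EG G p v)
    {s : ℝ → ℝ} (hs : Tendsto s (𝓝 0) (𝓝 t)) (hcs : ∀ r, ∃ a : G, a • γ (s r) = c r) :
    ∃ k : G, k • p = p ∧ ∃ a : ℝ, v = a • chartVelocity (E := E) p (fun r => k • γ r) t := by
  have : ContinuousSMul G M := ContMDiffSMul.continuousSMul (I := 𝓘(ℝ, EG)) (I' := 𝓘(ℝ, E)) ∞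
  have : IsTopologicalGroup G := topologicalGroup_of_lieGroup 𝓘(ℝ, EG) ∞
  choose a ha using hcs
  -- By compactness of `G`, the uncontrolled choice `a` converges along an ultrafilter, so no
  -- continuity of `a` is needed.
  set U : Ultrafilter ℝ := Ultrafilter.of (𝓝[≠] (0 : ℝ)) with hU
  have hUle : (U : Filter ℝ) ≤ 𝓝[≠] (0 : ℝ) := Ultrafilter.of_le _
  have hU0 : (U : Filter ℝ) ≤ 𝓝 0 := hUle.trans nhdsWithin_le_nhds
  have hUne : ∀ᶠ r in (U : Filter ℝ), r ≠ 0 := hUle self_mem_nhdsWithin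
  obtain ⟨k, -, hk⟩ := isCompact_univ.ultrafilter_le_nhds (U.map a) (by simp)
  have hak : Tendsto a U (𝓝 k) := hk
  have hsU : Tendsto s U (𝓝 t) := hs.mono_left hU0
  have hγc : Continuous γ := hγ.continuous
  have hkp : k • γ t = p := by
    have h1 : Tendsto (fun r => a r • γ (s r)) U (𝓝 (k • γ t)) :=
      hak.smul (hγc.continuousAt.tendsto.comp hsU)
    have h2 : Tendsto c U (𝓝 p) := hc0 ▸ hcc.tendsto.mono_left hU0
    exact tendsto_nhds_unique h1 (h2.congr fun r => (ha r).symm)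
  have hγd : MDifferentiableAt 𝓘(ℝ, ℝ) 𝓘(ℝ, E) γ t := hγ.mdifferentiable (by simp) t
  have hkd : MDifferentiableAt 𝓘(ℝ, ℝ) 𝓘(ℝ, E) (fun r => k • γ r) t :=
    (mdifferentiable_smul_left E EG k (γ t)).comp t hγd
  set w : E := chartVelocity (E := E) p (fun r => k • γ r) t with hw
  have hwn : IsNormalToOrbit g EG G p w :=
    (isPerpToOrbitAt_iff_isNormalToOrbit (c := fun r => k • γ r) hkp hkd).1
      (hperp.smul hiso hγd k)
  have hww : 0 < metricAt g p w w := by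
    rw [hw, metricAt_chartVelocity_smul (EG := EG) hiso hkp hγd]
    exact g.pos _ _ hvel
  refine ⟨k, by rw [← hp] at hkp ⊢; exact hkp, ?_⟩
  set ψ := chartAt E p with hψ
  have e1 : (fun r => ψ (c r) - ψ p - r • v) =o[(U : Filter ℝ)] fun r => r := by
    have := (hasDerivAt_iff_isLittleO_nhds_zero.1 hcv).mono hU0
    simpa [hc0] using this
  have e2 : (fun r => ψ (c r) - ψ (a r • γ t) - (s r - t) • w) =o[(U : Filter ℝ)]
      fun r => s r - t := by
    have := (isLittleO_smul_curve (E := E) (EG := EG) hγ hkp).comp_tendsto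
      (hak.prodMk_nhds hsU)
    refine this.congr_left fun r => ?_
    simp [ha]
    rfl
  set N : ℝ → ℝ := fun r => |r| + |s r - t| with hN
  have hrN : (fun r : ℝ => r) =O[(U : Filter ℝ)] N := Asymptotics.isBigO_of_le _ fun r => by
    rw [Real.norm_eq_abs, Real.norm_eq_abs, abs_of_nonneg (a := N r) (by positivity)]
    simp [hN]
  have hsN : (fun r : ℝ => s r - t) =O[(U : Filter ℝ)] N := Asymptotics.isBigO_of_le _ fun r => by
    rw [Real.norm_eq_abs, Real.norm_eq_abs, abs_of_nonneg (a := N r) (by positivity)]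
    simp [hN]
  set δ : ℝ → E := fun r => ψ (a r • γ t) - ψ p with hδ
  -- Subtracting the two expansions of `ψ (c r)` gives the displacement `δ` inside the orbit of `p`,
  -- with error measured by `N` since `s r - t` is not yet controlled by `r`.
  have e3 : (fun r => δ r - (r • v - (s r - t) • w)) =o[(U : Filter ℝ)] N := by
    refine ((e1.trans_isBigO hrN).sub (e2.trans_isBigO hsN)).congr_left fun r => ?_
    simp only [hδ]
    abel
  have hδN : δ =O[(U : Filter ℝ)] N := by
    have h1 : (fun r => r • v - (s r - t) • w) =O[(U : Filter ℝ)] N := by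
      refine Asymptotics.IsBigO.sub ?_ ?_
      · exact (Asymptotics.isBigO_of_le' (c := ‖v‖) _ fun r => by
          rw [norm_smul, mul_comm]).trans hrN
      · exact (Asymptotics.isBigO_of_le' (c := ‖w‖) _ fun r => by
          rw [norm_smul, mul_comm]).trans hsN
    refine (e3.isBigO.add h1).congr_left fun r => by abel
  have hu : Tendsto (fun r => a r * k⁻¹) U (𝓝 1) := by
    have := hak.mul_const k⁻¹
    rwa [mul_inv_cancel] at this
  have hkinv : k⁻¹ • p = γ t := by rw [← hkp, inv_smul_smul]
  have key : ∀ z : E, IsNormalToOrbit g EG G p z →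
      (fun r => r * metricAt g p z v - (s r - t) * metricAt g p z w) =o[(U : Filter ℝ)] N := by
    intro z hz
    have h1 := (isLittleO_normal_displacement (EG := EG) (G := G) p (metricAt g p z)
      hz).comp_tendsto hu
    have h2 : (fun r => metricAt g p z (δ r)) =o[(U : Filter ℝ)] N := by
      refine Asymptotics.IsLittleO.trans_isBigO (g := δ) ?_ hδN
      refine (h1.congr_left fun r => ?_).congr_right fun r => ?_ <;>
      simp only [Function.comp, mul_smul, hkinv] <;> rfl
    have h3 : (fun r => metricAt g p z (δ r - (r • v - (s r - t) • w))) =o[(U : Filter ℝ)] N :=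
      ((metricAt g p z).isBigO_comp _ _).trans_isLittleO e3
    refine (h2.sub h3).congr_left fun r => ?_
    simp only [map_sub, map_smul, smul_eq_mul]
    ring
  set A := metricAt g p w v with hA
  set b := metricAt g p w w with hb
  -- Pairing with `w`, with error constant `b / 2`, absorbs half of `|s r - t| * b` on the left.
  -- Thus `(s r - t) / r` is bounded and has a limit `q`.
  have hbd : ∀ᶠ r in (U : Filter ℝ), |s r - t| ≤ (2 * |A| / b + 1) * |r| := by
    filter_upwards [(key w hwn).def (half_pos hww)] with r hr
    have h1 : |r * A - (s r - t) * b| ≤ b / 2 * (|r| + |s r - t|) := by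
      rw [Real.norm_eq_abs, Real.norm_eq_abs, abs_of_nonneg (a := N r) (by positivity)] at hr
      exact hr
    have h2 : |(s r - t) * b| ≤ |r * A - (s r - t) * b| + |r * A| := by
      have := abs_sub (r * A) (r * A - (s r - t) * b)
      rw [sub_sub_cancel] at this
      linarith
    rw [abs_mul, abs_mul, abs_of_pos hww] at h2
    have h3 : |s r - t| * b ≤ (2 * |A| + b) * |r| := by nlinarith
    calc |s r - t| = |s r - t| * b / b := by field_simp
      _ ≤ (2 * |A| + b) * |r| / b := by gcongr
      _ = (2 * |A| / b + 1) * |r| := by field_simp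
  set C := 2 * |A| / b + 1 with hC
  have hNr : N =O[(U : Filter ℝ)] fun r : ℝ => r := by
    refine Asymptotics.IsBigO.of_bound (1 + C) ?_
    filter_upwards [hbd] with r hr
    rw [Real.norm_eq_abs, Real.norm_eq_abs, abs_of_nonneg (a := N r) (by positivity)]
    simp only [hN]
    linarith
  obtain ⟨q, -, hq⟩ := (isCompact_Icc (a := -C) (b := C)).ultrafilter_le_nhds
    (U.map fun r => (s r - t) / r) (by
      rw [le_principal_iff, Ultrafilter.mem_coe, Ultrafilter.mem_map]
      filter_upwards [hbd, hUne] with r hr hr0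
      rw [Set.mem_preimage, Set.mem_Icc, ← abs_le, abs_div, div_le_iff₀ (abs_pos.2 hr0)]
      exact hr)
  have hqlim : Tendsto (fun r => (s r - t) / r) U (𝓝 q) := hq
  refine ⟨q, ?_⟩
  -- Pairing with this `z` and dividing by `r` gives `⟨z, v⟩ - q ⟨z, w⟩ = ⟨z, z⟩ = 0`.
  set z := v - q • w with hz
  have hzn : IsNormalToOrbit g EG G p z := hv.sub_smul hwn q
  have l1 := ((key z hzn).trans_isBigO hNr).tendsto_div_nhds_zero
  have l2 : Tendsto (fun r => metricAt g p z v - (s r - t) / r * metricAt g p z w) U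
      (𝓝 (metricAt g p z v - q * metricAt g p z w)) :=
    tendsto_const_nhds.sub (hqlim.mul_const _)
  have l3 : metricAt g p z v - q * metricAt g p z w = 0 := by
    refine tendsto_nhds_unique l2 (l1.congr' ?_)
    filter_upwards [hUne] with r hr
    field_simp
  have l4 : metricAt g p z z = 0 := by
    conv_lhs => rw [hz, map_sub (metricAt g p (v - q • w)), map_smul, smul_eq_mul, ← hz]
    exact l3
  by_contra hne
  exact (metricAt_pos p (g := g) (v := z) (sub_ne_zero.2 hne)).ne' l4

end Transitivity

theorem continuousAt_chart_line {E : Type*} [NormedAddCommGroup E] [NormedSpace ℝ E] {M : Type*}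
    [TopologicalSpace M] [ChartedSpace E M] (p : M) (v : E) : ContinuousAt
    (fun r : ℝ => (chartAt E p).symm (chartAt E p p + r • v)) 0 := by
  refine ContinuousAt.comp (g := (chartAt E p).symm) (f := fun r : ℝ => chartAt E p p + r • v)
    ?_ (by fun_prop)
  simpa using (chartAt E p).continuousAt_symm (mem_chart_target E p)

/-! ### Isotropy along the horizontal geodesic. -/

section HorizontalLift

variable {E : Type*} [NormedAddCommGroup E] [NormedSpace ℝ E]
  {M : Type*} [TopologicalSpace M] [ChartedSpace E M] [IsManifold 𝓘(ℝ, E) ∞ M]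
  {g : Bundle.ContMDiffRiemannianMetric 𝓘(ℝ, E) ∞ E (fun x : M => TangentSpace 𝓘(ℝ, E) x)}
  {EG : Type*} [NormedAddCommGroup EG] [NormedSpace ℝ EG]
  {G : Type*} [Group G] [TopologicalSpace G] [ChartedSpace EG G] [MulAction G M]
  {γ : ℝ → M}

theorem IsHorizontalLift.eq_of_smul_eq (hγ : IsHorizontalLift (EG := EG) G g γ) {s t : ℝ}
    (hs : s ∈ Set.Icc (-1 : ℝ) 1) (ht : t ∈ Set.Icc (-1 : ℝ) 1) {a : G}
    (h : a • γ s = γ t) : s = t := by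
  obtain ⟨φ, hφ⟩ := hγ.orbitSpace
  have h1 : (Quotient.mk (MulAction.orbitRel G M) (γ t)) = Quotient.mk _ (γ s) :=
    Quotient.sound ⟨a, h⟩
  rw [← hφ s hs, ← hφ t ht, h1]

/-- The parameter is the image of the orbit of `c r` in `[-1, 1]`, continuous at `0` because the
quotient map and `φ` are. -/
theorem IsHorizontalLift.exists_orbit_parameter (hγ : IsHorizontalLift (EG := EG) G g γ) {t : ℝ}
    (ht : t ∈ Set.Icc (-1 : ℝ) 1) {c : ℝ → M} (hc : ContinuousAt c 0) (h0 : c 0 = γ t) :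
    ∃ s : ℝ → ℝ, Tendsto s (𝓝 0) (𝓝 t) ∧ ∀ r, ∃ a : G, a • γ (s r) = c r := by
  obtain ⟨φ, hφ⟩ := hγ.orbitSpace
  refine ⟨fun r => φ (Quotient.mk _ (c r)), ?_, fun r => ?_⟩
  · have h1 : ContinuousAt (fun r => ((φ (Quotient.mk _ (c r)) : Set.Icc (-1 : ℝ) 1) : ℝ)) 0 :=
      ((continuous_subtype_val.comp φ.continuous).comp
        continuous_quotient_mk').continuousAt.comp hc
    have h2 := h1.tendsto
    rwa [h0, hφ t ht] at h2
  · have h1 : φ (Quotient.mk _ (γ (φ (Quotient.mk _ (c r))))) = φ (Quotient.mk _ (c r)) :=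
      Subtype.ext (hφ _ (φ (Quotient.mk _ (c r))).2)
    exact Quotient.exact (φ.injective h1).symm

theorem IsHorizontalLift.mdifferentiable (hγ : IsHorizontalLift (EG := EG) G g γ) :
    MDifferentiable 𝓘(ℝ, ℝ) 𝓘(ℝ, E) γ :=
  hγ.geodesic.1.mdifferentiable (by simp)

theorem IsHorizontalLift.not_const (hγ : IsHorizontalLift (EG := EG) G g γ) (p : M) :
    γ ≠ fun _ => p := by
  intro h
  have h1 : (1 : G) • γ 0 = γ 1 := by rw [one_smul, h]
  have := hγ.eq_of_smul_eq (by norm_num) (by norm_num) h1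
  norm_num at this

theorem IsHorizontalLift.velocity_ne_zero [FiniteDimensional ℝ E] [T2Space M]
    (hγ : IsHorizontalLift (EG := EG) G g γ) (t : ℝ) :
    (velocity γ t : E) ≠ 0 := by
  intro h
  refine hγ.not_const (γ t) (hγ.geodesic.eq_of_deriv_eq (isGeodesic_const g (γ t)) (t := t)
    (IsManifold.chart_mem_maximalAtlas (γ t)) (mem_chart_source E (γ t)) rfl ?_)
  have h1 := velocity_eq_chartVelocity (hγ.mdifferentiable t)
  rw [h, chartVelocity] at h1
  have h2 : deriv (fun r => chartAt E (γ t) (γ r)) t = 0 := h1.symm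
  rw [h2]
  simp

/-- The isotropy group acts transitively on the normal directions, up to scaling. -/
theorem IsHorizontalLift.exists_eq_smul_comp_affine [FiniteDimensional ℝ E] [T2Space M]
    [FiniteDimensional ℝ EG] [T2Space G] [CompactSpace G] [LieGroup 𝓘(ℝ, EG) ∞ G]
    [ContMDiffSMul 𝓘(ℝ, EG) 𝓘(ℝ, E) ∞ G M]
    (hγ : IsHorizontalLift (EG := EG) G g γ)
    (hiso : ∀ (a : G) (x : M) (v w : TangentSpace 𝓘(ℝ, E) x),
      g.inner (a • x) (mfderiv 𝓘(ℝ, E) 𝓘(ℝ, E) (fun y : M => a • y) x v)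
        (mfderiv 𝓘(ℝ, E) 𝓘(ℝ, E) (fun y : M => a • y) x w) = g.inner x v w)
    {t : ℝ} (ht : t ∈ Set.Icc (-1 : ℝ) 1) {c : ℝ → M} (hc : IsGeodesic g c) (h0 : c 0 = γ t)
    (hperp : IsPerpToOrbitAt (EG := EG) G g c 0) :
    ∃ k : G, k • γ t = γ t ∧ ∃ a : ℝ, ∀ r, c r = k • γ (t + a * r) := by
  obtain ⟨s, hs, hcs⟩ := hγ.exists_orbit_parameter ht hc.1.continuous.continuousAt h0
  have he := IsManifold.chart_mem_maximalAtlas (I := 𝓘(ℝ, E)) (n := ∞) (γ t)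
  have hsrc : c 0 ∈ (chartAt E (γ t)).source := by rw [h0]; exact mem_chart_source E (γ t)
  have hcd : MDifferentiableAt 𝓘(ℝ, ℝ) 𝓘(ℝ, E) c 0 := hc.1.mdifferentiable (by simp) 0
  obtain ⟨k, hk, a, ha⟩ := exists_eq_smul_chartVelocity hiso hγ.geodesic.1 rfl (hγ.perp t)
    (hγ.velocity_ne_zero t) h0 hc.1.continuous.continuousAt
    (((contDiffAt_chart_comp he hc.1 hsrc).differentiableAt (by simp)).hasDerivAt)
    ((isPerpToOrbitAt_iff_isNormalToOrbit h0 hcd).1 hperp) hs hcs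
  refine ⟨k, hk, a, fun r => ?_⟩
  have hk' : IsGeodesic g (fun r => k • γ (t + a * r)) := (hγ.geodesic.comp_affine t a).smul EG hiso k
  refine congrFun (hc.eq_of_deriv_eq hk' he hsrc (by simp [h0, hk]) ?_) r
  rw [ha, chartVelocity, deriv_comp_mul_left a (fun x => chartAt E (γ t) (k • γ (t + x))) 0,
    deriv_comp_const_add (f := fun x => chartAt E (γ t) (k • γ x))]
  simp

/-- By the uniform expansion, for `k` near `h` the chart curve of `k • γ` minus the linear motion
with the velocity of `h • γ` has Lipschitz bound `ε / 2` at `t`; this bounds the difference of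
velocities. -/
theorem continuousOn_chartVelocity_smul [LieGroup 𝓘(ℝ, EG) ∞ G]
    [ContMDiffSMul 𝓘(ℝ, EG) 𝓘(ℝ, E) ∞ G M] (hγ : ContMDiff 𝓘(ℝ, ℝ) 𝓘(ℝ, E) ∞ γ) (t : ℝ) :
    ContinuousOn (fun k : G => chartVelocity (E := E) (γ t) (fun r => k • γ r) t)
      (MulAction.stabilizer G (γ t) : Set G) := by
  intro h hh
  rw [ContinuousWithinAt, Metric.tendsto_nhds]
  intro ε hε
  have h1 := ((isLittleO_smul_curve (E := E) (EG := EG) hγ (h := h) (t := t) hh).def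
    (half_pos hε))
  rw [nhds_prod_eq] at h1
  filter_upwards [nhdsWithin_le_nhds h1.curry, self_mem_nhdsWithin] with k hk hks
  have hkγ : ContMDiff 𝓘(ℝ, ℝ) 𝓘(ℝ, E) ∞ (fun r => k • γ r) :=
    (contMDiff_smul_left E EG k).comp hγ
  have hd : HasDerivAt (fun r => chartAt E (γ t) (k • γ r))
      (chartVelocity (E := E) (γ t) (fun r => k • γ r) t) t := by
    refine ((contDiffAt_chart_comp (c := fun r => k • γ r)
      (IsManifold.chart_mem_maximalAtlas (γ t)) hkγ ?_).differentiableAt (by simp)).hasDerivAt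
    rw [show k • γ t = γ t from hks]
    exact mem_chart_source E (γ t)
  have hd2 := hd.sub ((hasDerivAt_id t).smul_const
    (chartVelocity (E := E) (γ t) (fun r => h • γ r) t))
  have h2 := hd2.le_of_lip' (half_pos hε).le (hk.mono fun r hr => by
    refine le_of_eq_of_le ?_ hr
    congr 1
    simp only [Pi.sub_apply, id, sub_smul]
    abel)
  rw [dist_eq_norm]
  rw [one_smul] at h2
  linarith

/-- The isotropy group of an interior point of the orbit space fixes the horizontal geodesic. -/
theorem IsHorizontalLift.smul_eq_of_smul_zero_eq [FiniteDimensional ℝ E] [T2Space M]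
    [FiniteDimensional ℝ EG] [T2Space G] [CompactSpace G] [LieGroup 𝓘(ℝ, EG) ∞ G]
    [ContMDiffSMul 𝓘(ℝ, EG) 𝓘(ℝ, E) ∞ G M]
    (hγ : IsHorizontalLift (EG := EG) G g γ)
    (hiso : ∀ (a : G) (x : M) (v w : TangentSpace 𝓘(ℝ, E) x),
      g.inner (a • x) (mfderiv 𝓘(ℝ, E) 𝓘(ℝ, E) (fun y : M => a • y) x v)
        (mfderiv 𝓘(ℝ, E) 𝓘(ℝ, E) (fun y : M => a • y) x w) = g.inner x v w)
    {h : G} (hh : h • γ 0 = γ 0) (r : ℝ) : h • γ r = γ r := by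
  have : ContinuousSMul G M := ContMDiffSMul.continuousSMul (I := 𝓘(ℝ, EG)) (I' := 𝓘(ℝ, E)) ∞
  set p := γ 0 with hp
  set ψ := chartAt E p with hψ
  have he := IsManifold.chart_mem_maximalAtlas (I := 𝓘(ℝ, E)) (n := ∞) p
  have hsrc := mem_chart_source E p
  set W : G → E := fun k => chartVelocity (E := E) p (fun r => k • γ r) 0 with hW
  set b := g.inner (γ 0) (velocity γ 0) (velocity γ 0) with hb
  have hb0 : 0 < b := g.pos _ _ (hγ.velocity_ne_zero 0)
  have hWb : ∀ k : G, k • p = p → metricAt g p (W k) (W k) = b := fun k hk =>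
    metricAt_chartVelocity_smul (EG := EG) hiso hk (hγ.mdifferentiable 0)
  have hgeo : ∀ k : G, IsGeodesic g (fun r => k • γ r) := fun k => hγ.geodesic.smul EG hiso k
  have hWn : ∀ k : G, k • p = p → IsNormalToOrbit g EG G p (W k) := fun k hk =>
    (isPerpToOrbitAt_iff_isNormalToOrbit (c := fun r => k • γ r) hk
      ((hgeo k).1.mdifferentiable (by simp) 0)).1
      ((hγ.perp 0).smul hiso (hγ.mdifferentiable 0) k)
  -- Opposite velocities would identify `k • γ r` with `k' • γ (-r)`, placing `γ 1` and `γ (-1)` in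
  -- one orbit.
  have hopp : ∀ k k' : G, k • p = p → k' • p = p → W k ≠ -W k' := by
    intro k k' hk hk' heq
    have h1 : IsGeodesic g (fun r => k' • γ (0 + (-1) * r)) :=
      (hγ.geodesic.comp_affine 0 (-1)).smul EG hiso k'
    have h2 : (fun r => k • γ r) = fun r => k' • γ (0 + (-1) * r) := by
      refine (hgeo k).eq_of_deriv_eq h1 (t := 0) he (by rw [← hp, hk]; exact hsrc)
        (by simp [← hp, hk, hk']) ?_
      rw [deriv_comp_mul_left (-1) (fun x => ψ (k' • γ (0 + x))) 0,
        deriv_comp_const_add (f := fun x => ψ (k' • γ x))]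
      simpa [hW, chartVelocity] using heq
    have h3 := congrFun h2 1
    have h4 : (k'⁻¹ * k) • γ 1 = γ (-1) := by
      rw [mul_smul, h3, inv_smul_smul]
      norm_num
    have := hγ.eq_of_smul_eq (by norm_num) (by norm_num) h4
    norm_num at this
  have hall : ∀ v : E, IsNormalToOrbit g EG G p v → ∃ k : G, k • p = p ∧ ∃ a : ℝ, v = a • W k := by
    intro v hv
    -- A coordinate line suffices here: only its first derivative at `0` matters, so it need not be
    -- a geodesic.
    set c : ℝ → M := fun r => ψ.symm (ψ p + r • v) with hc
    have hc0 : c 0 = p := by simp [hc, ψ.left_inv hsrc]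
    have hcc : ContinuousAt c 0 := continuousAt_chart_line p v
    have hcv : HasDerivAt (fun r => ψ (c r)) v 0 := by
      have h1 : HasDerivAt (fun r : ℝ => ψ p + r • v) v 0 := by
        simpa using ((hasDerivAt_id (0 : ℝ)).smul_const v).const_add (ψ p)
      refine h1.congr_of_eventuallyEq ?_
      have h2 : ContinuousAt (fun r : ℝ => ψ p + r • v) 0 := by fun_prop
      filter_upwards [h2.eventually (ψ.open_target.mem_nhds (by simpa using ψ.map_source hsrc))]
        with r hr
      exact ψ.right_inv hr
    obtain ⟨s, hs, hcs⟩ := hγ.exists_orbit_parameter (t := 0) (by norm_num) hcc hc0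
    exact exists_eq_smul_chartVelocity hiso hγ.geodesic.1 rfl (hγ.perp 0)
      (hγ.velocity_ne_zero 0) hc0 hcc hcv hv hs hcs
  let V : Submodule ℝ E :=
    { carrier := {v | IsNormalToOrbit g EG G p v}
      add_mem' := fun {v w} hv hw => by
        have := IsNormalToOrbit.sub_smul hv hw (-1)
        simpa using this
      zero_mem' := by
        have := IsNormalToOrbit.sub_smul (hWn 1 (one_smul _ _)) (hWn 1 (one_smul _ _)) 1
        simpa using this
      smul_mem' := fun a v hv => by
        have h0 := IsNormalToOrbit.sub_smul hv hv 1
        have := IsNormalToOrbit.sub_smul h0 hv (-a)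
        simpa using this }
  have hWne : ∀ k : G, k • p = p → W k ≠ 0 := by
    intro k hk h0
    have := hWb k hk
    rw [h0] at this
    simp at this
    exact hb0.ne this
  have hdim : Module.finrank ℝ V ≤ 1 := by
    by_contra hlt
    have hrank : 1 < Module.rank ℝ V := Module.lt_rank_of_lt_finrank (by simpa using hlt)
    have hconn : IsPreconnected ({(0 : V)}ᶜ) :=
      (isConnected_compl_singleton_of_one_lt_rank hrank 0).isPreconnected
    -- Radial projection to the vectors of squared length `b`. The image is connected, and covered
    -- by the disjoint compact sets `O` and `-O`, both of which it meets.
    set ν : V → E := fun v => Real.sqrt (b / metricAt g p v v) • (v : E) with hν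
    have hpos : ∀ v : V, v ∈ ({(0 : V)}ᶜ : Set V) → 0 < metricAt g p (v : E) (v : E) :=
      fun v hv => metricAt_pos p (by simpa using hv)
    have hνc : ContinuousOn ν ({(0 : V)}ᶜ) := by
      refine ContinuousOn.smul ?_ continuous_subtype_val.continuousOn
      refine (ContinuousOn.div continuousOn_const ?_ fun v hv => (hpos v hv).ne').sqrt
      fun_prop
    have himg := hconn.image ν hνc
    set O : Set E := W '' (MulAction.stabilizer G p : Set G) with hO
    have hOc : IsCompact O := by
      refine IsCompact.image_of_continuousOn ?_ (continuousOn_chartVelocity_smul (EG := EG) hγ.geodesic.1 0)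
      refine IsClosed.isCompact ?_
      exact isClosed_eq (continuous_id.smul continuous_const) continuous_const
    have hνval : ∀ (v : V) (k : G) (a : ℝ), k • p = p → a ≠ 0 → (v : E) = a • W k →
        ν v = (a / |a|) • W k := by
      intro v k a hk ha hv
      have h1 : metricAt g p (v : E) (v : E) = a ^ 2 * b := by
        rw [hv, ← hWb k hk]
        simp
        ring
      simp only [hν]
      rw [h1, hv, smul_smul, show b / (a ^ 2 * b) = (|a|⁻¹) ^ 2 by
        rw [inv_pow, sq_abs]; field_simp, Real.sqrt_sq (by positivity)]
      congr 1
      field_simp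
    have hsub : ν '' ({(0 : V)}ᶜ) ⊆ O ∪ -O := by
      rintro _ ⟨v, hv, rfl⟩
      obtain ⟨k, hk, a, ha⟩ := hall v v.2
      have ha0 : a ≠ 0 := by
        rintro rfl
        rw [zero_smul] at ha
        exact hv (by simpa using ha)
      rw [hνval v k a hk ha0 ha]
      rcases lt_or_gt_of_ne ha0 with h | h
      · right
        refine ⟨k, hk, ?_⟩
        rw [abs_of_neg h, div_neg, div_self ha0]
        simp
      · left
        refine ⟨k, hk, ?_⟩
        rw [abs_of_pos h, div_self ha0]
        simp
    have h1p : (1 : G) • p = p := one_smul _ _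
    have hmem1 : (ν '' ({(0 : V)}ᶜ) ∩ O).Nonempty := by
      refine ⟨W 1, ⟨⟨W 1, hWn 1 h1p⟩, ?_, ?_⟩, ⟨1, h1p, rfl⟩⟩
      · intro h0
        exact hWne 1 h1p (congrArg Subtype.val h0)
      · rw [hνval _ 1 1 h1p one_ne_zero (by simp)]
        simp
    have hmem2 : (ν '' ({(0 : V)}ᶜ) ∩ -O).Nonempty := by
      refine ⟨-W 1, ⟨-⟨W 1, hWn 1 h1p⟩, ?_, ?_⟩, ⟨1, h1p, by simp⟩⟩
      · intro h0
        exact hWne 1 h1p (neg_eq_zero.1 (congrArg Subtype.val h0))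
      · rw [hνval _ 1 (-1) h1p (by norm_num) (by simp)]
        simp
    obtain ⟨_, -, ⟨k, hk, rfl⟩, ⟨k', hk', hkk'⟩⟩ := isPreconnected_closed_iff.1 himg O (-O)
      hOc.isClosed hOc.isClosed.neg hsub hmem1 hmem2
    exact hopp k' k hk' hk hkk'
  obtain ⟨v, hv⟩ := finrank_le_one_iff.1 hdim
  obtain ⟨x, hx⟩ := hv ⟨W h, hWn h hh⟩
  obtain ⟨y, hy⟩ := hv ⟨W 1, hWn 1 (one_smul _ _)⟩
  have hx' : x • (v : E) = W h := congrArg Subtype.val hx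
  have hy' : y • (v : E) = W 1 := congrArg Subtype.val hy
  have hxy : x ^ 2 = y ^ 2 := by
    have h1 := hWb h hh
    have h2 := hWb 1 (one_smul _ _)
    rw [← hx'] at h1
    rw [← hy'] at h2
    simp at h1 h2
    have h3 : metricAt g p (v : E) (v : E) ≠ 0 := by
      intro h0
      rw [h0] at h1
      simp at h1
      exact hb0.ne h1
    apply mul_right_cancel₀ h3
    linarith
  -- On a line, equal lengths leave only `W h = ± W 1`, and `hopp` excludes the minus sign.
  have hWh : W h = W 1 := by
    rcases sq_eq_sq_iff_eq_or_eq_neg.1 hxy with h1 | h1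
    · rw [← hx', ← hy', h1]
    · exact absurd (by rw [← hx', ← hy', h1, neg_smul]) (hopp h 1 hh (one_smul _ _))
  have hfin : (fun r => h • γ r) = fun r => (1 : G) • γ r :=
    (hgeo h).eq_of_deriv_eq (hgeo 1) (t := 0) he (by rw [← hp, hh]; exact hsrc)
      (by simp [← hp, hh]) hWh
  simpa using congrFun hfin r

end HorizontalLift

/-! ### Returns of `γ` to an orbit, and short segments in slices. -/

section HorizontalLift

variable {E : Type*} [NormedAddCommGroup E] [NormedSpace ℝ E]
  {M : Type*} [TopologicalSpace M] [ChartedSpace E M] [IsManifold 𝓘(ℝ, E) ∞ M]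
  {g : Bundle.ContMDiffRiemannianMetric 𝓘(ℝ, E) ∞ E (fun x : M => TangentSpace 𝓘(ℝ, E) x)}
  {EG : Type*} [NormedAddCommGroup EG] [NormedSpace ℝ EG]
  {G : Type*} [Group G] [TopologicalSpace G] [ChartedSpace EG G] [MulAction G M]
  {γ : ℝ → M}

/-- If `γ` returns to the orbit of a point `γ s` with `s ∈ [-1, 1]`, then a group element maps `γ`
to itself, up to an affine reparametrization. -/
theorem IsHorizontalLift.exists_smul_eq_comp_affine [FiniteDimensional ℝ E] [T2Space M]
    [FiniteDimensional ℝ EG] [T2Space G] [CompactSpace G] [LieGroup 𝓘(ℝ, EG) ∞ G]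
    [ContMDiffSMul 𝓘(ℝ, EG) 𝓘(ℝ, E) ∞ G M]
    (hγ : IsHorizontalLift (EG := EG) G g γ)
    (hiso : ∀ (a : G) (x : M) (v w : TangentSpace 𝓘(ℝ, E) x),
      g.inner (a • x) (mfderiv 𝓘(ℝ, E) 𝓘(ℝ, E) (fun y : M => a • y) x v)
        (mfderiv 𝓘(ℝ, E) 𝓘(ℝ, E) (fun y : M => a • y) x w) = g.inner x v w)
    {s t : ℝ} (hs : s ∈ Set.Icc (-1 : ℝ) 1) (ht : γ t ∈ MulAction.orbit G (γ s)) :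
    ∃ b : G, ∃ l : ℝ, l ≠ 0 ∧ ∀ r, b • γ (t + r) = γ (s + l * r) := by
  obtain ⟨a, ha⟩ := ht
  have ha : a • γ s = γ t := ha
  have hc : IsGeodesic g (fun r => a⁻¹ • γ (t + 1 * r)) :=
    (hγ.geodesic.comp_affine t 1).smul EG hiso a⁻¹
  have hperp : IsPerpToOrbitAt (EG := EG) G g (fun r => a⁻¹ • γ (t + 1 * r)) 0 := by
    refine IsPerpToOrbitAt.smul hiso ((hγ.geodesic.comp_affine t 1).1.mdifferentiable
      (by simp) 0) ?_ a⁻¹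
    exact IsPerpToOrbitAt.comp_affine (hγ.mdifferentiable _) (hγ.perp _)
  obtain ⟨k, -, l, hl⟩ := hγ.exists_eq_smul_comp_affine hiso hs hc
    (by simp [← ha]) hperp
  refine ⟨k⁻¹ * a⁻¹, l, ?_, fun r => ?_⟩
  -- With `l = 0` the geodesic `γ` would be constant.
  · rintro rfl
    refine hγ.not_const (a • k • γ s) (funext fun r => ?_)
    have := hl (r - t)
    simp only [one_mul, add_sub_cancel, zero_mul, add_zero] at this
    rw [← this, smul_inv_smul]
  · have := hl r
    rw [one_mul] at this
    rw [mul_smul, this, inv_smul_smul]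

/-- The point is the time-one value of `r ↦ a • γ (t + s * r)`, whose initial speed is `|s|` times
that of `γ`. -/
theorem IsHorizontalLift.mem_slice [ContMDiffSMul 𝓘(ℝ, EG) 𝓘(ℝ, E) ∞ G M]
    [LieGroup 𝓘(ℝ, EG) ∞ G]
    (hγ : IsHorizontalLift (EG := EG) G g γ)
    (hiso : ∀ (a : G) (x : M) (v w : TangentSpace 𝓘(ℝ, E) x),
      g.inner (a • x) (mfderiv 𝓘(ℝ, E) 𝓘(ℝ, E) (fun y : M => a • y) x v)
        (mfderiv 𝓘(ℝ, E) 𝓘(ℝ, E) (fun y : M => a • y) x w) = g.inner x v w)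
    (a : G) (t : ℝ) {ε : ℝ} (hε : 0 < ε) :
    ∀ᶠ s in 𝓝 (0 : ℝ), a • γ (t + s) ∈ slice (EG := EG) G g (a • γ t) ε := by
  set f : ℝ → ℝ := fun x => g.inner (γ x) (velocity γ x) (velocity γ x) with hf
  have hlim : ∀ᶠ s in 𝓝 (0 : ℝ), Real.sqrt (s * (s * f t)) < ε := by
    have h1 : ContinuousAt (fun s : ℝ => Real.sqrt (s * (s * f t))) 0 := by fun_prop
    exact h1.eventually (gt_mem_nhds (by simpa using hε))
  filter_upwards [hlim] with s hs
  have hgs := hγ.geodesic.comp_affine t s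
  have hd : MDifferentiableAt 𝓘(ℝ, ℝ) 𝓘(ℝ, E) (fun r => γ (t + s * r)) 0 :=
    hgs.1.mdifferentiable (by simp) 0
  refine ⟨fun r => a • γ (t + s * r), hgs.smul EG hiso a, by simp, ?_, ?_, by simp⟩
  · refine IsPerpToOrbitAt.smul hiso hd ?_ a
    exact IsPerpToOrbitAt.comp_affine (hγ.geodesic.1.mdifferentiable (by simp) _) (hγ.perp _)
  · rw [velocity_smul EG a hd]
    have h1 := hiso a (γ (t + s * 0)) (velocity (fun r => γ (t + s * r)) 0)
      (velocity (fun r => γ (t + s * r)) 0)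
    rw [h1, velocity_comp_affine t s 0 (hγ.geodesic.1.mdifferentiable (by simp) _)]
    have hsmul : ∀ x, g.inner (γ x) (s • velocity γ x) (s • velocity γ x) = s * (s * f x) :=
      fun x => by simp [hf]
    have h2 := hsmul (t + s * 0)
    have h3 : f (t + s * 0) = f t := by simp
    rw [h3] at h2
    exact h2 ▸ hs

end HorizontalLift

/-! ### Normality of `H` in `K` versus triviality on the slice. -/

theorem proposition2p2
    {E : Type*} [NormedAddCommGroup E] [NormedSpace ℝ E] [FiniteDimensional ℝ E]
    {M : Type*} [TopologicalSpace M] [T2Space M] [CompactSpace M] [ConnectedSpace M]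
    [ChartedSpace E M] [IsManifold 𝓘(ℝ, E) ∞ M]
    (g : Bundle.ContMDiffRiemannianMetric 𝓘(ℝ, E) ∞ E (fun x : M => TangentSpace 𝓘(ℝ, E) x))
    {EG : Type*} [NormedAddCommGroup EG] [NormedSpace ℝ EG] [FiniteDimensional ℝ EG]
    {G : Type*} [Group G] [TopologicalSpace G] [T2Space G] [CompactSpace G]
    [ChartedSpace EG G] [LieGroup 𝓘(ℝ, EG) ∞ G]
    [MulAction G M] [ContMDiffSMul 𝓘(ℝ, EG) 𝓘(ℝ, E) ∞ G M]
    (hM : IsCohomogeneityOne (EG := EG) G g)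
    (γ : ℝ → M) (hγ : IsHorizontalLift (EG := EG) G g γ)
    -- The principal isotropy group.
    (H : Subgroup G) (hH : H = MulAction.stabilizer G (γ 0))
    -- One of the two nonprincipal orbits, assumed singular, and its isotropy group.
    (τ : ℝ) (hτ : τ = 1 ∨ τ = -1)
    (hsing : orbitDim (E := E) (EG := EG) G (γ τ) < orbitDim (E := E) (EG := EG) G (γ 0))
    (K : Subgroup G) (hK : K = MulAction.stabilizer G (γ τ))
    (S : Set M) (hS : S = MulAction.orbit G (γ τ)) :
    -- At each point of `S` on the fixed geodesic, and for a slice of any radius.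
    ∀ t : ℝ, γ t ∈ S → ∀ ε : ℝ, 0 < ε →
      ((H ≤ K ∧ (H.subgroupOf K).Normal) ↔
        ∀ h ∈ H, ∀ q ∈ slice (EG := EG) G g (γ t) ε, h • q = q) := by
  have hiso := hM.isometric
  have hτm : τ ∈ Set.Icc (-1 : ℝ) 1 := by rcases hτ with rfl | rfl <;> norm_num
  have hfix : ∀ h : G, h ∈ H ↔ ∀ r, h • γ r = γ r := by
    intro h
    rw [hH, MulAction.mem_stabilizer_iff]
    exact ⟨fun hh r => hγ.smul_eq_of_smul_zero_eq hiso hh r, fun hh => hh 0⟩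
  intro t ht ε hε
  rw [hS] at ht
  obtain ⟨b, l, hl0, hb⟩ := hγ.exists_smul_eq_comp_affine hiso hτm ht
  have hbinv : ∀ r, b⁻¹ • γ (τ + l * r) = γ (t + r) := fun r => by rw [← hb, inv_smul_smul]
  have hbt : b • γ t = γ τ := by simpa using hb 0
  -- Since `l ≠ 0`, `b` maps `γ` onto itself, so it normalizes the pointwise stabilizer `H`.
  have hconj : ∀ h ∈ H, b * h * b⁻¹ ∈ H := by
    intro h hh
    rw [hfix] at hh ⊢
    intro r
    have h1 : r = τ + l * ((r - τ) / l) := by field_simp; ring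
    rw [h1, mul_smul, mul_smul, hbinv, hh, hb]
  have hconj' : ∀ h ∈ H, b⁻¹ * h * b ∈ H := by
    intro h hh
    rw [hfix] at hh ⊢
    intro r
    have h1 : r = t + (r - t) := by ring
    rw [h1, mul_smul, mul_smul, hb, hh, hbinv]
  have hHK : H ≤ K := by
    intro h hh
    rw [hK, MulAction.mem_stabilizer_iff]
    exact (hfix h).1 hh τ
  constructor
  · rintro ⟨-, hnorm⟩ h hh q ⟨c, hc, hc0, hcp, -, rfl⟩
    -- The normal geodesic `b • c` at `γ τ` is `k • γ` reparametrized, so `b * h * b⁻¹` fixes it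
    -- once its conjugate by `k⁻¹` lies in `H`.
    obtain ⟨k, hk, a, ha⟩ := hγ.exists_eq_smul_comp_affine hiso hτm (hc.smul EG hiso b)
      (by rw [hc0, hbt]) (hcp.smul hiso (hc.1.mdifferentiable (by simp) 0) b)
    have hkK : k ∈ K := by rw [hK, MulAction.mem_stabilizer_iff, hk]
    have h1 : b * h * b⁻¹ ∈ H := hconj h hh
    have h2 : k⁻¹ * (b * h * b⁻¹) * k ∈ H := by
      have := hnorm.conj_mem ⟨b * h * b⁻¹, hHK h1⟩ h1 ⟨k⁻¹, K.inv_mem hkK⟩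
      simpa [Subgroup.mem_subgroupOf] using this
    have h3 := (hfix _).1 h2 (τ + a * 1)
    have h4 : b • h • c 1 = b • c 1 := by
      rw [mul_smul, ← ha 1, mul_smul, mul_smul, mul_smul, inv_smul_smul, ← eq_inv_smul_iff,
        inv_inv, ← ha 1] at h3
      exact h3
    exact smul_left_cancel b h4
  · intro hact
    refine ⟨hHK, ⟨?_⟩⟩
    rintro ⟨h, hhK⟩ hh ⟨k, hkK⟩
    rw [Subgroup.mem_subgroupOf] at hh ⊢
    simp only [Subgroup.coe_mul, Subgroup.coe_inv] at hh ⊢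
    have hkτ : k⁻¹ • γ τ = γ τ := by
      have := K.inv_mem hkK
      rwa [hK, MulAction.mem_stabilizer_iff] at this
    -- Short pieces of `(b⁻¹ * k⁻¹) • γ` around time `τ` lie in the slice at `γ t`, where `b⁻¹ * h *
    -- b ∈ H` acts trivially. Undoing the translation, `k * h * k⁻¹` fixes `γ` near `τ`, hence
    -- everywhere.
    have hbase : (b⁻¹ * k⁻¹) • γ τ = γ t := by rw [mul_smul, hkτ, ← hbt, inv_smul_smul]
    have hslice := hγ.mem_slice hiso (b⁻¹ * k⁻¹) τ hε
    rw [hbase] at hslice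
    have hev : (fun r => (k * h * k⁻¹) • γ r) =ᶠ[𝓝 τ] γ := by
      have hsub : Tendsto (fun r => r - τ) (𝓝 τ) (𝓝 0) := by
        have : ContinuousAt (fun r => r - τ) τ := by fun_prop
        simpa using this.tendsto
      filter_upwards [hsub.eventually hslice] with r hr
      rw [add_sub_cancel] at hr
      have h1 := hact _ (hconj' h hh) _ hr
      simp only [mul_smul, smul_inv_smul] at h1
      rw [smul_left_cancel_iff] at h1
      rw [mul_smul, mul_smul, h1, smul_inv_smul]
    have heq := IsGeodesic.eq_of_eventuallyEq (hγ.geodesic.smul EG hiso (k * h * k⁻¹))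
      hγ.geodesic hev
    exact (hfix _).2 fun r => congrFun heq r
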